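/- Let $\theta\in\mathbb{R}$ and let $\mathcal{H}=\{z\in\mathbb{C}\setminus\{0\}:\theta-\frac{\pi}{2}<\arg z<\theta+\frac{\pi}{2}\}$ be the corresponding open half-plane; let $\log$ be the branch of the logarithm on $\mathcal{H}$ with imaginary part in $(\theta-\frac\pi2,\theta+\frac\pi2)$, and $z^{-\alpha}=e^{-\alpha\log z}$. Let $a,w_1,\dots,w_d\in\mathcal{H}$, $\mathbf{w}=(w_1,\dots,w_d)$. The Barnes zeta function is $$\zeta_{\rm B}(\alpha,a|\mathbf{w})=\sum_{\mathbf{n}\in\mathbb{N}_0^d}(a+\mathbf{n}\cdot\mathbf{w})^{-\alpha}\qquad(\Re\alpha>d),$$ continued analytically to $\mathbb{C}\setminus\{1,\dots,d\}$. Notation. For a function $f$, $F[f(a+x)]_{x=\mathbf{w}}=\sum_{\emptyset\ne T\subseteq\{1,\dots,d\}}(-1)^{d-|T|}f\bigl(a+\sum_{i\in T}w_i\bigr)$. The polynomials $B_n(a|\mathbf{w})$ are defined by $z^d e^{az}\prod_{i=1}^d\frac{w_i}{e^{w_iz}-1}=\sum_{n\ge0}B_n(a|\mathbf{w})\frac{z^n}{n!}$,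 and the Bernoullian functions ${}_dS_n$ are the polynomials in $a$ with ${}_dS_n'(a)=\frac{n!}{(n+d-1)!\prod_i w_i}B_{n+d-1}(a|\mathbf{w})$ and ${}_dS_n(0)=0$; ${}_dS_n^{(d)}$ is the $d$-th derivative in $a$. $H_k=\sum_{i=1}^k 1/i$, $H_0=0$, and $\mathcal{C}_{M-1}=\{0,1,\dots,M-1\}^d$. Then the analytic continuation exists, and for every $q=1,\dots,d$ the function $\alpha\mapsto\zeta_{\rm B}(\alpha,a|\mathbf{w})$ has at most a simple pole at $\alpha=q$, the limit below exists, and the finite part (the constant term of the Laurent expansion at $\alpha=q$) is $$F.P.[\zeta_{\rm B}(\alpha,a|\mathbf{w})]_{\alpha=q}=\lim_{M\to\infty}\Biggl[\frac{(-1)^q}{(q-1)!}\sum_{m=0}^{d-q}\frac{{}_dS_m^{(d)}(0)}{m!\,(d-q-m)!}F\bigl[(a+x)^{d-q-m}\log(a+x)\bigr]_{x=M\mathbf{w}}+\sum_{\mathbf{n}\in\mathcal{C}_{M-1}}(a+\mathbf{n}\cdot\mathbf{w})^{-q}\Biggr]$$ $$\qquad+\frac{(-1)^{d-q+1}}{(q-1)!}\sum_{m=0}^{d-q}\frac{{}_dS_m^{(d)}(0)\,a^{d-q-m}}{m!\,(d-q-m)!}\,(H_{q-1}-H_{d-q-m}).$$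 -/

import Mathlib

open Filter Topology Polynomial

noncomputable section

namespace Barnes

/-- The open half-plane through the origin centred on the ray of angle `θ`, that is
`{z : θ - π/2 < arg z < θ + π/2}`, where `arg` is read modulo `2π`. -/
def halfPlane (θ : ℝ) : Set ℂ :=
  {z | 0 < (z * Complex.exp (-(θ * Complex.I))).re}

/-- The branch of the logarithm whose imaginary part lies in `(θ - π/2, θ + π/2)` on
`halfPlane θ`. As `θ` runs through `ℝ`, every branch on every half-plane arises. -/
def branchLog (θ : ℝ) (z : ℂ) : ℂ :=
  Complex.log (z * Complex.exp (-(θ * Complex.I))) + θ * Complex.I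

/-- The lattice point `a + n · w`. -/
def latticePoint {d : ℕ} (a : ℂ) (w : Fin d → ℂ) (n : Fin d → ℕ) : ℂ :=
  a + ∑ i, (n i : ℂ) * w i

/-- `Z` is the Barnes zeta function `α ↦ ζ_B(α, a | w)`: it is holomorphic away from
`1, 2, …, d`, and for `Re α > d` it is the sum of the series of the `(a + n · w) ^ (-α)`. These
conditions determine `Z` away from `1, 2, …, d`. -/
structure IsZeta {d : ℕ} (θ : ℝ) (a : ℂ) (w : Fin d → ℂ) (Z : ℂ → ℂ) : Prop where
  differentiableOn : DifferentiableOn ℂ Z {α | ∃ q : ℕ, 1 ≤ q ∧ q ≤ d ∧ α = q}ᶜ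
  hasSum : ∀ α : ℂ, (d : ℝ) < α.re →
    HasSum (fun n : Fin d → ℕ => Complex.exp (-α * branchLog θ (latticePoint a w n))) (Z α)

/-- The Barnes zeta function `α ↦ ζ_B(α, a | w)`, continued analytically. -/
def zeta {d : ℕ} (θ : ℝ) (a : ℂ) (w : Fin d → ℂ) : ℂ → ℂ :=
  Classical.epsilon (IsZeta θ a w)

/-- `f` has at `z₀` at most a simple pole, and the constant term of its Laurent expansion there,
its finite part, is `c`. -/
def HasFinitePart (f : ℂ → ℂ) (z₀ c : ℂ) : Prop :=
  ∃ (r : ℂ) (g : ℂ → ℂ), AnalyticAt ℂ g z₀ ∧ g z₀ = c ∧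
    ∀ᶠ z in 𝓝[≠] z₀, f z = r / (z - z₀) + g z

/-- The formal power series `w z / (exp (w z) - 1)`, as the inverse of
`(exp (w z) - 1) / (w z) = ∑ (w z) ^ k / (k + 1)!`. -/
def toddSeries (w : ℂ) : PowerSeries ℂ :=
  (PowerSeries.mk fun k => w ^ k / ((k + 1).factorial : ℂ))⁻¹

/-- The higher order Bernoulli polynomials `B_n(X | w)`, with generating function
`∑ B_n(X | w) z ^ n / n! = exp (X z) ∏ w_i z / (exp (w_i z) - 1)`. -/
def bernoulliPoly {d : ℕ} (w : Fin d → ℂ) (n : ℕ) : ℂ[X] :=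
  C (n.factorial : ℂ) * PowerSeries.coeff n
    (PowerSeries.rescale (X : ℂ[X]) (PowerSeries.exp ℂ[X]) *
      PowerSeries.map (C : ℂ →+* ℂ[X]) (∏ i, toddSeries (w i)))

/-- The antiderivative of a polynomial that vanishes at `0`. -/
def antideriv (p : ℂ[X]) : ℂ[X] :=
  p.sum fun k c => monomial (k + 1) (c / ((k : ℂ) + 1))

/-- The Bernoullian functions `_dS_n(X)`, with
`_dS_n' = n! / ((n + d - 1)! ∏ w_i) B_{n+d-1}(X | w)` and `_dS_n(0) = 0` (for `d ≥ 1`). -/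
def bernoullian {d : ℕ} (w : Fin d → ℂ) (n : ℕ) : ℂ[X] :=
  antideriv (C ((n.factorial : ℂ) / (((n + d - 1).factorial : ℂ) * ∏ i, w i)) *
    bernoulliPoly w (n + d - 1))

/-- The number `_dS_m^{(d)}(0)`, the superscript being the order of differentiation. -/
def bernoullianCoeff {d : ℕ} (w : Fin d → ℂ) (m : ℕ) : ℂ :=
  (derivative^[d] (bernoullian w m)).eval 0

/-- The symbol `F[f(a+x)]_{x=w}`: the sum of `(-1) ^ (d - |T|) f(a + ∑_{i ∈ T} w_i)` over the
non-empty subsets `T` of the index set. -/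
def symbolF {d : ℕ} (f : ℂ → ℂ) (a : ℂ) (w : Fin d → ℂ) : ℂ :=
  ∑ T ∈ (Finset.univ : Finset (Finset (Fin d))).filter (fun T => T.Nonempty),
    (-1) ^ (d - T.card) * f (a + ∑ i ∈ T, w i)

theorem derivative_antideriv (p : ℂ[X]) : derivative (antideriv p) = p := by
  unfold antideriv
  conv_rhs => rw [← p.sum_monomial_eq]
  simp only [Polynomial.sum_def, map_sum, derivative_monomial]
  refine Finset.sum_congr rfl fun k _ => ?_
  have h : (k : ℂ) + 1 ≠ 0 := Nat.cast_add_one_ne_zero k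
  simp [h]

theorem eval_zero_antideriv (p : ℂ[X]) : (antideriv p).eval 0 = 0 := by
  simp [antideriv, Polynomial.sum_def, eval_finsetSum]

end Barnes

end

noncomputable section

namespace Barnes

/-! ### Powers on a half-plane -/

/-! Write `D` for `d/dz`. The iterated difference with steps `w_i` is the operator `∏ (exp (w_i D) -
1)`, with formal inverse `∑ toddCoeff w k * D ^ (k - d)`. Applied to `(1 - α) ⋯ (d - α) z ^ (-α)`,
the inverse has terms `toddCoeff w k * fallProd d k α * z ^ (d - k - α)`, which are entire in `α`;
truncation gives `mainTerm`. By Taylor's formula its iterated difference recovers the original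
function up to an error of order `height ^ (-(N + Re α))` (`norm_errTerm_le`). Over a box the
differences telescope to the corners `a + M ∑_{i ∈ T} w_i` (`sum_box_iterDiff`). The corner `T = ∅`
stays at `a`, the others run to infinity. So `R(α) = (-1) ^ d mainTerm(a) + ∑ errors` is holomorphic
on a ball that grows with `N`, does not depend on `N` there (`regZeta_eq`), and equals `(1 - α) ⋯ (d
- α) ζ_B` for `Re α > d`. This gives the continuation. Near `q`, `ζ_B = -(R / c) / (α - q)` with `c`
the product of the other factors, so the finite part is `-(R / c)'(q)`. At `α = q` the expansion
reduces to a polynomial of degree `d - q < d`, annihilated by the iterated difference, which makes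
`R(q)` explicit (`regZeta_natCast`). Differentiation in `α` produces logarithms, a polynomial and
decaying powers; hence `R'(q)` is a limit of box sums and logarithmic corners plus an explicit
polynomial in `a` (`tendsto_regularized_sum`). The harmonic numbers are logarithmic derivatives of
the products. -/

/-- The power `z ^ s` formed with `branchLog θ`. -/
def branchPow (θ : ℝ) (s z : ℂ) : ℂ :=
  Complex.exp (s * branchLog θ z)

/-- The distance from `z` to the boundary line of `halfPlane θ`, with a sign. -/
def height (θ : ℝ) (z : ℂ) : ℝ :=
  (z * Complex.exp (-(θ * Complex.I))).re

theorem height_add (θ : ℝ) (z u : ℂ) : height θ (z + u) = height θ z + height θ u := by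
  simp only [height, add_mul, Complex.add_re]

theorem height_real_mul (θ : ℝ) (t : ℝ) (z : ℂ) : height θ (t * z) = t * height θ z := by
  simp only [height, mul_assoc, Complex.re_ofReal_mul]

theorem height_natCast_mul (θ : ℝ) (n : ℕ) (z : ℂ) : height θ (n * z) = n * height θ z := by
  simpa using height_real_mul θ n z

theorem height_sum {ι : Type*} (θ : ℝ) (s : Finset ι) (f : ι → ℂ) :
    height θ (∑ i ∈ s, f i) = ∑ i ∈ s, height θ (f i) := by
  simp only [height, Finset.sum_mul, Complex.re_sum]

theorem norm_exp_neg_mul_I (θ : ℝ) : ‖Complex.exp (-(θ * Complex.I))‖ = 1 := by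
  simp [Complex.norm_exp]

theorem height_le_norm (θ : ℝ) (z : ℂ) : height θ z ≤ ‖z‖ := by
  refine (Complex.re_le_norm _).trans ?_
  rw [norm_mul, norm_exp_neg_mul_I, mul_one]

theorem ne_zero_of_height_pos {θ : ℝ} {z : ℂ} (hz : 0 < height θ z) : z ≠ 0 := by
  rintro rfl
  simp [height] at hz

theorem exp_branchLog (θ : ℝ) {z : ℂ} (hz : z ≠ 0) : Complex.exp (branchLog θ z) = z := by
  rw [branchLog, Complex.exp_add, Complex.exp_log (mul_ne_zero hz (Complex.exp_ne_zero _)),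
    mul_assoc, ← Complex.exp_add]
  simp

theorem branchPow_natCast (θ : ℝ) (n : ℕ) {z : ℂ} (hz : z ≠ 0) :
    branchPow θ n z = z ^ n := by
  rw [branchPow, Complex.exp_nat_mul, exp_branchLog θ hz]

theorem branchPow_neg_natCast (θ : ℝ) (n : ℕ) {z : ℂ} (hz : z ≠ 0) :
    branchPow θ (-n) z = (z ^ n)⁻¹ := by
  rw [branchPow, neg_mul, Complex.exp_neg, Complex.exp_nat_mul, exp_branchLog θ hz]

theorem hasDerivAt_branchLog {θ : ℝ} {z : ℂ} (hz : 0 < height θ z) :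
    HasDerivAt (branchLog θ) z⁻¹ z := by
  have h1 : HasDerivAt (fun z : ℂ => z * Complex.exp (-(θ * Complex.I)))
      (Complex.exp (-(θ * Complex.I))) z := by
    simpa using (hasDerivAt_id z).mul_const (Complex.exp (-(θ * Complex.I)))
  have h2 := (h1.clog (Or.inl hz)).add_const (θ * Complex.I)
  refine HasDerivAt.congr_deriv h2 ?_
  have := ne_zero_of_height_pos hz
  have := Complex.exp_ne_zero (-(θ * Complex.I))
  field_simp

theorem hasDerivAt_branchPow {θ : ℝ} {z : ℂ} (hz : 0 < height θ z) (s : ℂ) :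
    HasDerivAt (branchPow θ s) (s * branchPow θ (s - 1) z) z := by
  have h := ((hasDerivAt_branchLog hz).const_mul s).cexp
  refine HasDerivAt.congr_deriv h ?_
  rw [branchPow, sub_mul, Complex.exp_sub, one_mul, exp_branchLog θ (ne_zero_of_height_pos hz)]
  ring

theorem hasDerivAt_branchPow_exponent (θ : ℝ) (z c α : ℂ) :
    HasDerivAt (fun α => branchPow θ (c - α) z) (-(branchLog θ z * branchPow θ (c - α) z)) α := by
  have h := (((hasDerivAt_id α).const_sub c).mul_const (branchLog θ z)).cexp
  refine HasDerivAt.congr_deriv h ?_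
  simp only [branchPow, id]
  ring

theorem branchLog_re (θ : ℝ) (z : ℂ) : (branchLog θ z).re = Real.log ‖z‖ := by
  simp [branchLog, Complex.log_re, norm_exp_neg_mul_I]

theorem abs_branchLog_im_le (θ : ℝ) (z : ℂ) : |(branchLog θ z).im| ≤ Real.pi + |θ| := by
  have h : (branchLog θ z).im = (z * Complex.exp (-(θ * Complex.I))).arg + θ := by
    simp [branchLog, Complex.log_im]
  rw [h]
  exact (abs_add_le _ _).trans (add_le_add_left (Complex.abs_arg_le_pi _) _)

/-- The modulus of `exp (s log z)` is `‖z‖ ^ Re s * exp (-Im s * Im log z)`, and the branch has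
bounded imaginary part. -/
theorem norm_branchPow_le (θ : ℝ) (s : ℂ) {z : ℂ} (hz : z ≠ 0) :
    ‖branchPow θ s z‖ ≤ ‖z‖ ^ s.re * Real.exp (|s.im| * (Real.pi + |θ|)) := by
  rw [branchPow, Complex.norm_exp, Complex.mul_re, branchLog_re, sub_eq_add_neg, Real.exp_add,
    mul_comm s.re, ← Real.rpow_def_of_pos (norm_pos_iff.mpr hz)]
  gcongr
  refine (neg_le_abs _).trans ?_
  rw [abs_mul]
  gcongr
  exact abs_branchLog_im_le θ z

/-- For a nonpositive exponent `‖z‖` may be replaced by the smaller `height θ z`, which is additive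
and so easy to bound below on sums. -/
theorem norm_branchPow_le_height {θ : ℝ} {s : ℂ} (hs : s.re ≤ 0) {z : ℂ} (hz : 0 < height θ z) :
    ‖branchPow θ s z‖ ≤ height θ z ^ s.re * Real.exp (|s.im| * (Real.pi + |θ|)) := by
  refine (norm_branchPow_le θ s (ne_zero_of_height_pos hz)).trans
    (mul_le_mul_of_nonneg_right ?_ (Real.exp_pos _).le)
  exact Real.rpow_le_rpow_of_nonpos hz (height_le_norm θ z) hs

theorem tendsto_branchPow_zero {θ : ℝ} {s : ℂ} (hs : s.re < 0) {ι : Type*} {l : Filter ι}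
    {z : ι → ℂ} (hz : Tendsto (fun i => height θ (z i)) l atTop) :
    Tendsto (fun i => branchPow θ s (z i)) l (𝓝 0) := by
  have h0 : Tendsto (fun i => height θ (z i) ^ s.re * Real.exp (|s.im| * (Real.pi + |θ|)))
      l (𝓝 0) := by
    have h := ((tendsto_rpow_neg_atTop (neg_pos.mpr hs)).comp hz).mul_const
      (Real.exp (|s.im| * (Real.pi + |θ|)))
    simpa [Function.comp_def] using h
  refine squeeze_zero_norm' ?_ h0
  filter_upwards [hz.eventually_gt_atTop 0] with i hi
  exact norm_branchPow_le_height hs.le hi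

/-- Taylor's theorem on `[0, 1]` for a sequence of functions each the derivative of its
predecessor. -/
theorem norm_sub_taylorSum_le (J : ℕ) {C : ℝ} (f : ℕ → ℝ → ℂ)
    (hf : ∀ j < J, ∀ t ∈ Set.Icc (0 : ℝ) 1, HasDerivAt (f j) (f (j + 1) t) t)
    (hC : ∀ t ∈ Set.Icc (0 : ℝ) 1, ‖f J t‖ ≤ C) (t : ℝ) (ht : t ∈ Set.Icc (0 : ℝ) 1) :
    ‖f 0 t - ∑ j ∈ Finset.range J, f j 0 * (t : ℂ) ^ j / (j.factorial : ℂ)‖ ≤ C := by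
  induction J generalizing f t with
  | zero => simpa using hC t ht
  | succ J ih =>
    -- The derivative of the Taylor remainder of `f 0` is the remainder of `f 1` of one order less;
    -- the mean value inequality integrates its bound.
    have key := fun s hs => ih (fun j => f (j + 1)) (fun j hj => hf (j + 1) (by omega)) hC s hs
    have hd : ∀ s ∈ Set.Icc (0 : ℝ) 1,
        HasDerivAt (fun t : ℝ => f 0 t -
          ∑ j ∈ Finset.range (J + 1), f j 0 * (t : ℂ) ^ j / (j.factorial : ℂ))
          (f 1 s - ∑ j ∈ Finset.range J, f (j + 1) 0 * (s : ℂ) ^ j / (j.factorial : ℂ)) s := by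
      intro s hs
      refine (hf 0 (by omega) s hs).sub ?_
      simp only [Finset.sum_range_succ' _ J, pow_zero, mul_one]
      refine HasDerivAt.add_const _ (HasDerivAt.fun_sum fun j _ => ?_)
      have h := (((Complex.ofRealCLM.hasDerivAt (x := s)).pow (j + 1)).const_mul
        (f (j + 1) 0)).div_const ((j + 1).factorial : ℂ)
      refine HasDerivAt.congr_deriv h ?_
      have h1 : (j.factorial : ℂ) ≠ 0 := by exact_mod_cast j.factorial_ne_zero
      have h2 : (j : ℂ) + 1 ≠ 0 := Nat.cast_add_one_ne_zero j
      simp [Nat.factorial_succ]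
      field_simp
    have := norm_image_sub_le_of_norm_deriv_le_segment' (C := C)
      (fun s hs => (hd s hs).hasDerivWithinAt) (fun s hs => key s ⟨hs.1, hs.2.le⟩) t ht
    have hC0 : 0 ≤ C := (norm_nonneg _).trans (hC t ht)
    simp only [Finset.sum_range_succ' _ J] at this ⊢
    simp at this ⊢
    exact this.trans (mul_le_of_le_one_right hC0 ht.2)

/-! ### Alternating sums over subsets -/

theorem prod_sub_one {R : Type*} [CommRing R] {d : ℕ} (x : Fin d → R) :
    ∏ i, (x i - 1) = ∑ T : Finset (Fin d), (-1) ^ (d - T.card) * ∏ i ∈ T, x i := by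
  simp only [sub_eq_add_neg, Fintype.prod_add, Finset.prod_const, Finset.card_compl,
    Fintype.card_fin]
  exact Finset.sum_congr rfl fun T _ => mul_comm _ _

/-- The iterated forward difference of `f` at `a` with steps `w`. -/
def iterDiff {d : ℕ} (f : ℂ → ℂ) (a : ℂ) (w : Fin d → ℂ) : ℂ :=
  ∑ T : Finset (Fin d), (-1) ^ (d - T.card) * f (a + ∑ i ∈ T, w i)

theorem iterDiff_eq {d : ℕ} (f : ℂ → ℂ) (a : ℂ) (w : Fin d → ℂ) :
    iterDiff f a w = (-1) ^ d * f a + symbolF f a w := by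
  rw [iterDiff, symbolF,
    ← Finset.sum_filter_add_sum_filter_not Finset.univ (fun T : Finset (Fin d) => T.Nonempty),
    add_comm]
  congr 1
  rw [show (Finset.univ : Finset (Finset (Fin d))).filter (fun T => ¬ T.Nonempty) = {∅} by
    ext T; simp]
  simp

/-- Summation over a box telescopes iterated differences. -/
theorem sum_box_iterDiff {d : ℕ} (f : ℂ → ℂ) (a : ℂ) (w : Fin d → ℂ) (M : ℕ) :
    ∑ n ∈ Fintype.piFinset (fun _ : Fin d => Finset.range M), iterDiff f (latticePoint a w n) w =
      iterDiff f a (fun i => (M : ℂ) * w i) := by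
  -- In the group algebra of `(ℂ, +)`, `x i` stands for translation by `w i`, and `φ` lets
  -- translations act on `f` at `a`. The claim becomes `∏ (x i - 1) * ∑ x ^ n = ∏ (x i ^ M - 1)`, a
  -- product of geometric sums.
  let x : Fin d → AddMonoidAlgebra ℂ ℂ := fun i => AddMonoidAlgebra.single (w i) 1
  let φ : AddMonoidAlgebra ℂ ℂ →ₗ[ℂ] ℂ :=
    (Finsupp.linearCombination ℂ fun z => f (a + z)) ∘ₗ
      (AddMonoidAlgebra.coeffLinearEquiv ℂ).toLinearMap
  have hφ : ∀ z c, φ (AddMonoidAlgebra.single z c) = c * f (a + z) := by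
    intro z c
    change Finsupp.linearCombination ℂ (fun z => f (a + z)) (AddMonoidAlgebra.single z c).coeff = _
    simp [AddMonoidAlgebra.coeff_single]
  have hsign : ∀ (k : ℕ) (y : AddMonoidAlgebra ℂ ℂ), φ ((-1) ^ k * y) = (-1) ^ k * φ y := by
    intro k y
    rcases k.even_or_odd with hk | hk <;> simp [hk.neg_one_pow]
  have key : (∏ i, (x i - 1)) * ∑ n ∈ Fintype.piFinset (fun _ : Fin d => Finset.range M),
      ∏ i, x i ^ n i = ∏ i, (x i ^ M - 1) := by
    rw [← Finset.prod_univ_sum (fun _ : Fin d => Finset.range M) (fun i j => x i ^ j),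
      ← Finset.prod_mul_distrib]
    exact Finset.prod_congr rfl fun i _ => mul_geom_sum _ _
  have key' := congrArg φ key
  simp only [prod_sub_one, Finset.mul_sum, Finset.sum_mul, map_sum, mul_assoc, hsign] at key'
  simp only [x, AddMonoidAlgebra.single_pow, AddMonoidAlgebra.prod_single,
    AddMonoidAlgebra.single_mul_single, hφ, one_pow, Finset.prod_const_one, one_mul,
    nsmul_eq_mul] at key'
  simp only [iterDiff, latticePoint]
  rw [← key']
  refine Finset.sum_congr rfl fun n _ => Finset.sum_congr rfl fun T _ => ?_
  rw [add_assoc, add_comm (∑ i, (n i : ℂ) * w i)]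

/-! ### Exponential generating functions of alternating sums -/

theorem prod_rescale_exp {ι : Type*} (s : Finset ι) (u : ι → ℂ) :
    ∏ i ∈ s, PowerSeries.rescale (u i) (PowerSeries.exp ℂ) =
      PowerSeries.rescale (∑ i ∈ s, u i) (PowerSeries.exp ℂ) := by
  classical
  induction s using Finset.induction_on with
  | empty => ext n; simp
  | insert i s hi ih =>
    rw [Finset.prod_insert hi, Finset.sum_insert hi, ih, PowerSeries.exp_mul_exp_eq_exp_add]

theorem coeff_rescale_exp (u : ℂ) (n : ℕ) :
    PowerSeries.coeff n (PowerSeries.rescale u (PowerSeries.exp ℂ)) = u ^ n / n.factorial := by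
  simp [PowerSeries.coeff_rescale, PowerSeries.coeff_exp, div_eq_mul_inv]

/-- The last factor is the series inverted in `toddSeries`. -/
theorem rescale_exp_sub_one (u : ℂ) :
    PowerSeries.rescale u (PowerSeries.exp ℂ) - 1 =
      PowerSeries.C u * PowerSeries.X *
        PowerSeries.mk (fun k => u ^ k / ((k + 1).factorial : ℂ)) := by
  ext n
  rw [mul_assoc, PowerSeries.coeff_C_mul, map_sub, coeff_rescale_exp]
  cases n with
  | zero => simp
  | succ n =>
    rw [PowerSeries.coeff_succ_X_mul, PowerSeries.coeff_mk, PowerSeries.coeff_one]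
    simp [pow_succ]
    ring

theorem coeff_prod_rescale_exp_sub_one {d : ℕ} (w : Fin d → ℂ) (n : ℕ) :
    PowerSeries.coeff n (∏ i, (PowerSeries.rescale (w i) (PowerSeries.exp ℂ) - 1)) =
      ∑ T : Finset (Fin d), (-1) ^ (d - T.card) * ((∑ i ∈ T, w i) ^ n / n.factorial) := by
  rw [prod_sub_one, map_sum]
  refine Finset.sum_congr rfl fun T _ => ?_
  rw [prod_rescale_exp, ← coeff_rescale_exp]
  have h : ((-1) ^ (d - T.card) : PowerSeries ℂ) = PowerSeries.C ((-1) ^ (d - T.card)) := by simp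
  rw [h, PowerSeries.coeff_C_mul]

/-- Up to `n!`, the difference is the coefficient of `X ^ n` in `exp (a X) ∏ (exp (w_i X) - 1)`, a
series divisible by `X ^ d`. -/
theorem iterDiff_pow_eq_zero {d n : ℕ} (hn : n < d) (a : ℂ) (w : Fin d → ℂ) :
    iterDiff (fun z => z ^ n) a w = 0 := by
  have h : iterDiff (fun z => z ^ n) a w = n.factorial *
      PowerSeries.coeff n (PowerSeries.rescale a (PowerSeries.exp ℂ) *
        ∏ i, (PowerSeries.rescale (w i) (PowerSeries.exp ℂ) - 1)) := by
    rw [prod_sub_one, Finset.mul_sum, map_sum, Finset.mul_sum, iterDiff]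
    refine Finset.sum_congr rfl fun T _ => ?_
    have h : ((-1) ^ (d - T.card) : PowerSeries ℂ) = PowerSeries.C ((-1) ^ (d - T.card)) := by simp
    rw [prod_rescale_exp, h, mul_left_comm, PowerSeries.exp_mul_exp_eq_exp_add,
      PowerSeries.coeff_C_mul, coeff_rescale_exp]
    have : (n.factorial : ℂ) ≠ 0 := by exact_mod_cast n.factorial_ne_zero
    field_simp
  rw [h]
  simp only [rescale_exp_sub_one, mul_assoc, mul_left_comm _ PowerSeries.X,
    Finset.prod_mul_distrib, Finset.prod_const, Finset.card_univ, Fintype.card_fin]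
  rw [mul_left_comm, PowerSeries.coeff_X_pow_mul', if_neg (by omega), mul_zero]

/-! ### The coefficients `_dS_m^{(d)}(0) / m!` -/

/-- The coefficients of `∏ (exp (w_i z) - 1)⁻¹ = ∑ toddCoeff w k * z ^ (k - d)`. -/
def toddCoeff {d : ℕ} (w : Fin d → ℂ) (k : ℕ) : ℂ :=
  PowerSeries.coeff k (∏ i, toddSeries (w i)) / ∏ i, w i

/-- Comparison of coefficients in `∏ toddSeries (w i) * ∏ (exp (w_i X) - 1) = (∏ w_i) X ^ d`. This
is the formal inversion behind the expansion. -/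
theorem sum_antidiagonal_toddCoeff {d : ℕ} (w : Fin d → ℂ) (hw : ∀ i, w i ≠ 0) (m : ℕ) :
    ∑ k ∈ Finset.range (m + 1), toddCoeff w k *
      (∑ T : Finset (Fin d), (-1) ^ (d - T.card) *
        ((∑ i ∈ T, w i) ^ (m - k) / (m - k).factorial)) = if m = d then 1 else 0 := by
  have hprod : (∏ i, toddSeries (w i)) *
      ∏ i, (PowerSeries.rescale (w i) (PowerSeries.exp ℂ) - 1) =
      PowerSeries.C (∏ i, w i) * PowerSeries.X ^ d := by
    rw [← Finset.prod_mul_distrib]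
    have : ∀ i, toddSeries (w i) * (PowerSeries.rescale (w i) (PowerSeries.exp ℂ) - 1) =
        PowerSeries.C (w i) * PowerSeries.X := by
      intro i
      rw [rescale_exp_sub_one, mul_comm, mul_assoc, toddSeries, PowerSeries.mul_inv_cancel, mul_one]
      simp
    simp [this, Finset.prod_mul_distrib]
  have h := congrArg (PowerSeries.coeff m) hprod
  rw [PowerSeries.coeff_mul, PowerSeries.coeff_C_mul, PowerSeries.coeff_X_pow,
    Finset.Nat.sum_antidiagonal_eq_sum_range_succ_mk] at h
  have hw0 : ∏ i, w i ≠ 0 := Finset.prod_ne_zero_iff.mpr fun i _ => hw i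
  have hsum : ∀ k, toddCoeff w k * (∑ T : Finset (Fin d), (-1) ^ (d - T.card) *
      ((∑ i ∈ T, w i) ^ (m - k) / (m - k).factorial)) =
      PowerSeries.coeff k (∏ i, toddSeries (w i)) * PowerSeries.coeff (m - k)
        (∏ i, (PowerSeries.rescale (w i) (PowerSeries.exp ℂ) - 1)) / ∏ i, w i := by
    intro k
    rw [← coeff_prod_rescale_exp_sub_one, toddCoeff, div_mul_eq_mul_div]
  rw [Finset.sum_congr rfl fun k _ => hsum k, ← Finset.sum_div, h, mul_div_cancel_left₀ _ hw0]

/-- One derivative undoes `antideriv`; the other `d - 1`, at `0`, extract the coefficient of `X ^ (d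
- 1)` in `B_{m+d-1}`. The factor `exp (X z)` supplies that power only with `z ^ (d - 1)`, leaving `z
^ m` for the Todd product. -/
theorem bernoullianCoeff_eq {d : ℕ} (hd : 1 ≤ d) (w : Fin d → ℂ) (m : ℕ) :
    bernoullianCoeff w m = m.factorial * toddCoeff w m := by
  obtain ⟨e, rfl⟩ : ∃ e, d = e + 1 := ⟨d - 1, by omega⟩
  have hcoeff : (bernoulliPoly w (m + e)).coeff e =
      (m + e).factorial * (PowerSeries.coeff m (∏ i, toddSeries (w i)) / e.factorial) := by
    rw [bernoulliPoly, coeff_C_mul, PowerSeries.coeff_mul, finsetSum_coeff,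
      Finset.sum_eq_single (e, m)]
    · have h : algebraMap ℚ ℂ[X] (1 / (e.factorial : ℚ)) = C (1 / (e.factorial : ℂ)) := by
        rw [IsScalarTower.algebraMap_apply ℚ ℂ ℂ[X]]
        simp
      rw [PowerSeries.coeff_rescale, PowerSeries.coeff_exp, PowerSeries.coeff_map, h,
        mul_assoc, ← C_mul, coeff_X_pow_mul',
        if_pos le_rfl, Nat.sub_self, coeff_C_zero]
      ring
    · rintro ⟨i, j⟩ hij hne
      have h : algebraMap ℚ ℂ[X] (1 / (i.factorial : ℚ)) = C (1 / (i.factorial : ℂ)) := by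
        rw [IsScalarTower.algebraMap_apply ℚ ℂ ℂ[X]]
        simp
      have hi : i ≠ e := by
        rintro rfl
        have := Finset.HasAntidiagonal.mem_antidiagonal.mp hij
        exact hne (by simp at this ⊢; omega)
      rw [PowerSeries.coeff_rescale, PowerSeries.coeff_exp, PowerSeries.coeff_map, h,
        mul_assoc, ← C_mul, mul_comm, coeff_C_mul, coeff_X_pow, if_neg hi.symm, mul_zero]
    · intro h
      exact absurd (by simp [add_comm]) h
  rw [bernoullianCoeff, bernoullian, Function.iterate_succ_apply, derivative_antideriv,
    iterate_derivative_C_mul, eval_C_mul, ← coeff_zero_eq_eval_zero, coeff_iterate_derivative,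
    show m + (e + 1) - 1 = m + e by omega, zero_add, hcoeff, toddCoeff, Nat.descFactorial_self]
  have h1 : ((m + e).factorial : ℂ) ≠ 0 := by exact_mod_cast (m + e).factorial_ne_zero
  have h2 : (e.factorial : ℂ) ≠ 0 := by exact_mod_cast e.factorial_ne_zero
  rw [nsmul_eq_mul]
  field_simp

/-! ### The Euler–Maclaurin expansion of `z ^ (-α)` -/

/-- The product `(d - α) (d - 1 - α) ⋯ (d - m + 1 - α)`. -/
def fallProd (d m : ℕ) (α : ℂ) : ℂ :=
  ∏ i ∈ Finset.range m, ((d : ℂ) - i - α)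

theorem differentiable_fallProd (d m : ℕ) : Differentiable ℂ (fallProd d m) := by
  unfold fallProd
  fun_prop

/-- These functions are the successive derivatives of `z ^ (d - α)`. No factor `d - i - α` is
divided by, so the chain survives at the poles. -/
theorem hasDerivAt_fallProd_mul_branchPow {θ : ℝ} {z : ℂ} (hz : 0 < height θ z) (d m : ℕ) (α : ℂ) :
    HasDerivAt (fun z => fallProd d m α * branchPow θ ((d : ℂ) - m - α) z)
      (fallProd d (m + 1) α * branchPow θ ((d : ℂ) - (m + 1 : ℕ) - α) z) z := by
  refine ((hasDerivAt_branchPow hz _).const_mul (fallProd d m α)).congr_deriv ?_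
  rw [fallProd, fallProd, Finset.prod_range_succ, mul_assoc, Nat.cast_add_one,
    show (d : ℂ) - m - α - 1 = d - (m + 1) - α by ring]

/-- Taylor's formula along the segment from `z` to `z + u`, where the height never drops below that
of `z`. The order `J = N + d - k` makes the last derivative a multiple of `z ^ (-N - α)` for every
`k`. -/
theorem norm_sub_taylorSum_branchPow_le {θ : ℝ} {z u : ℂ} (hz : 0 < height θ z)
    (hu : 0 ≤ height θ u) (d k J N : ℕ) (hJ : k + J = N + d) {α : ℂ} (hα : 0 ≤ N + α.re) :
    ‖fallProd d k α * branchPow θ ((d : ℂ) - k - α) (z + u) -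
        ∑ j ∈ Finset.range J, fallProd d (k + j) α *
          branchPow θ ((d : ℂ) - (k + j : ℕ) - α) z * (u ^ j / (j.factorial : ℂ))‖ ≤
      ‖fallProd d (N + d) α‖ * (height θ z ^ (-(N + α.re)) *
        Real.exp (|α.im| * (Real.pi + |θ|))) * ‖u‖ ^ J := by
  have hpos : ∀ t ∈ Set.Icc (0 : ℝ) 1, height θ z ≤ height θ (z + t * u) := by
    intro t ht
    rw [height_add, height_real_mul]
    exact le_add_of_nonneg_right (mul_nonneg ht.1 hu)
  have key := norm_sub_taylorSum_le J (fun j (t : ℝ) => fallProd d (k + j) α *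
    branchPow θ ((d : ℂ) - (k + j : ℕ) - α) (z + t * u) * u ^ j)
    (C := ‖fallProd d (N + d) α‖ * (height θ z ^ (-(N + α.re)) *
        Real.exp (|α.im| * (Real.pi + |θ|))) * ‖u‖ ^ J) ?_ ?_ 1 ⟨zero_le_one, le_rfl⟩
  · simpa [mul_assoc, mul_div_assoc] using key
  · intro j _ t ht
    have h1 : HasDerivAt (fun t : ℝ => z + (t : ℂ) * u) u t := by
      simpa using ((Complex.ofRealCLM.hasDerivAt (x := t)).mul_const u).const_add z
    have h2 := ((hasDerivAt_fallProd_mul_branchPow (hz.trans_le (hpos t ht)) d (k + j) α).comp t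
      h1).mul_const (u ^ j)
    refine h2.congr_deriv ?_
    rw [pow_succ, ← add_assoc]
    ring
  · intro t ht
    have h0 := hz.trans_le (hpos t ht)
    rw [norm_mul, norm_mul, norm_pow, hJ]
    gcongr
    have hs : ((d : ℂ) - (N + d : ℕ) - α) =
        ((-(N + α.re) : ℝ) : ℂ) + ((-α.im : ℝ) : ℂ) * Complex.I := by
      apply Complex.ext <;> simp
      ring
    have hre : ((d : ℂ) - (N + d : ℕ) - α).re = -(N + α.re) := by rw [hs]; simp
    have him : ((d : ℂ) - (N + d : ℕ) - α).im = -α.im := by rw [hs]; simp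
    refine (norm_branchPow_le_height (by rw [hre]; linarith) h0).trans ?_
    rw [hre, him, abs_neg]
    refine mul_le_mul_of_nonneg_right ?_ (Real.exp_pos _).le
    exact Real.rpow_le_rpow_of_nonpos hz (hpos t ht) (by linarith)

/-- The truncated expansion of `(∏ (exp (w_i D) - 1))⁻¹ z ^ (-α)`, multiplied by
`(1 - α) ⋯ (d - α)`. -/
def mainTerm {d : ℕ} (θ : ℝ) (w : Fin d → ℂ) (N : ℕ) (α z : ℂ) : ℂ :=
  ∑ k ∈ Finset.range (N + d),
    toddCoeff w k * (fallProd d k α * branchPow θ ((d : ℂ) - k - α) z)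

/-- The remainder in the expansion of `z ^ (-α)`. -/
def errTerm {d : ℕ} (θ : ℝ) (w : Fin d → ℂ) (N : ℕ) (α z : ℂ) : ℂ :=
  fallProd d d α * branchPow θ (-α) z - iterDiff (mainTerm θ w N α) z w

/-- The Taylor polynomials of all terms, collected by `m = k + j`, cancel except at `m = d` by
`sum_antidiagonal_toddCoeff`, and that term is `fallProd d d α * z ^ (-α)`. Only Taylor remainders
are left. The bound `1 ≤ N` keeps `m = d` inside the truncation. -/
theorem errTerm_eq {d : ℕ} (θ : ℝ) {w : Fin d → ℂ} (hw : ∀ i, w i ≠ 0) {N : ℕ} (hN : 1 ≤ N)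
    (α z : ℂ) :
    errTerm θ w N α z = -∑ T : Finset (Fin d), ∑ k ∈ Finset.range (N + d),
      (-1) ^ (d - T.card) * (toddCoeff w k *
        (fallProd d k α * branchPow θ ((d : ℂ) - k - α) (z + ∑ i ∈ T, w i) -
          ∑ j ∈ Finset.range (N + d - k), fallProd d (k + j) α *
            branchPow θ ((d : ℂ) - (k + j : ℕ) - α) z *
              ((∑ i ∈ T, w i) ^ j / (j.factorial : ℂ)))) := by
  set h : ℕ → ℂ := fun m => fallProd d m α * branchPow θ ((d : ℂ) - m - α) z with hh
  have h1 : ∑ T : Finset (Fin d), ∑ k ∈ Finset.range (N + d),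
      (-1) ^ (d - T.card) * (toddCoeff w k * ∑ j ∈ Finset.range (N + d - k), h (k + j) *
        ((∑ i ∈ T, w i) ^ j / (j.factorial : ℂ))) = h d := by
    calc _ = ∑ k ∈ Finset.range (N + d), ∑ j ∈ Finset.range (N + d - k),
          toddCoeff w k * (∑ T : Finset (Fin d), (-1) ^ (d - T.card) *
            ((∑ i ∈ T, w i) ^ j / (j.factorial : ℂ))) * h (k + j) := by
          rw [Finset.sum_comm]
          refine Finset.sum_congr rfl fun k _ => ?_
          simp only [Finset.mul_sum, Finset.sum_mul]
          rw [Finset.sum_comm]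
          exact Finset.sum_congr rfl fun j _ => Finset.sum_congr rfl fun T _ => by ring
      _ = ∑ m ∈ Finset.range (N + d), ∑ k ∈ Finset.range (m + 1),
          toddCoeff w k * (∑ T : Finset (Fin d), (-1) ^ (d - T.card) *
            ((∑ i ∈ T, w i) ^ (m - k) / ((m - k).factorial : ℂ))) * h m := by
          rw [← Finset.sum_range_diag_flip (N + d) (fun k j => toddCoeff w k *
            (∑ T : Finset (Fin d), (-1) ^ (d - T.card) *
              ((∑ i ∈ T, w i) ^ j / (j.factorial : ℂ))) * h (k + j))]
          refine Finset.sum_congr rfl fun m _ => Finset.sum_congr rfl fun k hk => ?_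
          rw [Nat.add_sub_cancel' (by simpa [Nat.lt_succ_iff] using hk)]
      _ = ∑ m ∈ Finset.range (N + d), (if m = d then 1 else 0) * h m := by
          refine Finset.sum_congr rfl fun m _ => ?_
          rw [← Finset.sum_mul, sum_antidiagonal_toddCoeff w hw]
      _ = h d := by
          simp
          omega
  have h2 : fallProd d d α * branchPow θ (-α) z = h d := by simp [hh]
  rw [errTerm, h2, ← h1, iterDiff, ← Finset.sum_sub_distrib, ← Finset.sum_neg_distrib]
  refine Finset.sum_congr rfl fun T _ => ?_
  rw [mainTerm, Finset.mul_sum, ← Finset.sum_sub_distrib, ← Finset.sum_neg_distrib]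
  refine Finset.sum_congr rfl fun k _ => ?_
  ring

/-- The constant in the estimate of `errTerm`. -/
def errConst {d : ℕ} (θ : ℝ) (w : Fin d → ℂ) (N : ℕ) (α : ℂ) : ℝ :=
  ∑ T : Finset (Fin d), ∑ k ∈ Finset.range (N + d), ‖toddCoeff w k‖ *
    (‖fallProd d (N + d) α‖ * Real.exp (|α.im| * (Real.pi + |θ|)) *
      ‖∑ i ∈ T, w i‖ ^ (N + d - k))

theorem continuous_errConst {d : ℕ} (θ : ℝ) (w : Fin d → ℂ) (N : ℕ) :
    Continuous (errConst θ w N) := by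
  have := (differentiable_fallProd d (N + d)).continuous
  unfold errConst
  fun_prop

theorem errConst_nonneg {d : ℕ} (θ : ℝ) (w : Fin d → ℂ) (N : ℕ) (α : ℂ) :
    0 ≤ errConst θ w N α := by
  unfold errConst
  positivity

theorem height_sum_nonneg {ι : Type*} {θ : ℝ} {w : ι → ℂ} (hw : ∀ i, 0 < height θ (w i))
    (T : Finset ι) : 0 ≤ height θ (∑ i ∈ T, w i) := by
  rw [height_sum]
  exact Finset.sum_nonneg fun i _ => (hw i).le

theorem norm_errTerm_le {d : ℕ} {θ : ℝ} {w : Fin d → ℂ} (hw : ∀ i, 0 < height θ (w i)) {N : ℕ}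
    (hN : 1 ≤ N) {α z : ℂ} (hα : 0 ≤ N + α.re) (hz : 0 < height θ z) :
    ‖errTerm θ w N α z‖ ≤ errConst θ w N α * height θ z ^ (-(N + α.re)) := by
  rw [errTerm_eq θ (fun i => ne_zero_of_height_pos (hw i)) hN, norm_neg, errConst, Finset.sum_mul]
  refine (norm_sum_le _ _).trans (Finset.sum_le_sum fun T _ => ?_)
  rw [Finset.sum_mul]
  refine (norm_sum_le _ _).trans (Finset.sum_le_sum fun k hk => ?_)
  rw [norm_mul, norm_mul, norm_pow, norm_neg, norm_one, one_pow, one_mul, mul_assoc]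
  refine mul_le_mul_of_nonneg_left ?_ (norm_nonneg _)
  refine (norm_sub_taylorSum_branchPow_le hz (height_sum_nonneg hw T) d k (N + d - k) N
    (by have := Finset.mem_range.mp hk; omega) hα).trans_eq ?_
  ring

/-! ### Lattice sums -/

theorem monotone_box (d : ℕ) :
    Monotone fun M : ℕ => Fintype.piFinset (fun _ : Fin d => Finset.range M) :=
  fun _ _ h => Fintype.piFinset_subset _ _ fun _ => Finset.range_mono h

theorem tendsto_box (d : ℕ) :
    Tendsto (fun M : ℕ => Fintype.piFinset (fun _ : Fin d => Finset.range M)) atTop atTop := by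
  refine tendsto_atTop_finset_of_monotone (monotone_box d) fun n => ?_
  refine ⟨∑ i, n i + 1, Fintype.mem_piFinset.mpr fun i => Finset.mem_range.mpr ?_⟩
  exact Nat.lt_succ_of_le (Finset.single_le_sum (fun _ _ => Nat.zero_le _) (Finset.mem_univ i))

theorem tendsto_sum_box {d : ℕ} {f : (Fin d → ℕ) → ℂ} {s : ℂ} (hf : HasSum f s) :
    Tendsto (fun M : ℕ => ∑ n ∈ Fintype.piFinset (fun _ : Fin d => Finset.range M), f n)
      atTop (𝓝 s) := by
  have h : Tendsto (fun t : Finset (Fin d → ℕ) => ∑ n ∈ t, f n) atTop (𝓝 s) := by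
    simpa [HasSum] using hf
  exact h.comp (tendsto_box d)

/-- Comparison with the sum of `‖x‖ ^ (-s)` over the lattice `ℤ ^ d`, whose sup norm is at most `1 +
∑ n i` on `ℕ ^ d`. -/
theorem summable_one_add_sum_rpow (d : ℕ) {s : ℝ} (hs : (d : ℝ) < s) :
    Summable fun n : Fin d → ℕ => (1 + ∑ i, (n i : ℝ)) ^ (-s) := by
  let b := Pi.basisFun ℝ (Fin d)
  let L : Submodule ℤ (Fin d → ℝ) := Submodule.span ℤ (Set.range b)
  have hmem : ∀ n : Fin d → ℕ, (fun i => (n i : ℝ)) ∈ L := by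
    intro n
    have : (fun i => (n i : ℝ)) = ∑ i, (n i : ℤ) • b i := by
      ext j
      simp [b, Finset.sum_apply, Pi.single_apply]
    rw [this]
    exact Submodule.sum_mem _ fun i _ => Submodule.smul_mem _ _ (Submodule.subset_span ⟨i, rfl⟩)
  have hrank : Module.finrank ℤ L = d := by
    rw [ZLattice.rank ℝ L]
    simp
  have hsum := ZLattice.summable_norm_rpow L (-s) (by rw [hrank]; linarith)
  have hinj : Function.Injective fun n : Fin d → ℕ => (⟨fun i => (n i : ℝ), hmem n⟩ : L) := by
    intro n m h
    ext i
    exact Nat.cast_injective (R := ℝ) (congrFun (congrArg Subtype.val h) i)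
  refine Summable.of_norm_bounded_eventually (hsum.comp_injective hinj) ?_
  -- The comparison fails at `n = 0`, where the real power `0 ^ (-s)` is `0`; one exceptional index
  -- is harmless.
  refine (Set.finite_singleton (0 : Fin d → ℕ)).subset fun n hn => ?_
  by_contra hne
  refine hn ?_
  have hn0 : (fun i => (n i : ℝ)) ≠ 0 := by
    intro h
    refine hne ?_
    ext i
    simpa using congrFun h i
  have hle : ‖fun i => (n i : ℝ)‖ ≤ 1 + ∑ i, (n i : ℝ) := by
    rw [pi_norm_le_iff_of_nonneg (by positivity)]
    intro i
    rw [Real.norm_natCast]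
    have := Finset.single_le_sum (f := fun i => (n i : ℝ)) (fun _ _ => Nat.cast_nonneg _)
      (Finset.mem_univ i)
    linarith
  refine (Real.norm_of_nonneg (by positivity)).trans_le ?_
  exact Real.rpow_le_rpow_of_nonpos 
    (norm_pos_iff.mpr fun h => hn0 (congrArg Subtype.val h)) hle
    (by linarith [(Nat.cast_nonneg d : (0 : ℝ) ≤ d)])

theorem exists_mul_le_height_latticePoint {d : ℕ} {θ : ℝ} {a : ℂ} {w : Fin d → ℂ}
    (ha : 0 < height θ a) (hw : ∀ i, 0 < height θ (w i)) :
    ∃ c : ℝ, 0 < c ∧ ∀ n : Fin d → ℕ,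
      c * (1 + ∑ i, (n i : ℝ)) ≤ height θ (latticePoint a w n) := by
  have h : ∀ᶠ c : ℝ in 𝓝[>] 0, 0 < c ∧ c ≤ height θ a ∧ ∀ i, c ≤ height θ (w i) := by
    refine (eventually_mem_nhdsWithin).and (Eventually.and ?_ (eventually_all.mpr fun i => ?_))
    · filter_upwards [Ioo_mem_nhdsGT ha] with c hc using hc.2.le
    · filter_upwards [Ioo_mem_nhdsGT (hw i)] with c hc using hc.2.le
  obtain ⟨c, hc, hca, hcw⟩ := h.exists
  refine ⟨c, hc, fun n => ?_⟩
  rw [latticePoint, height_add, height_sum, mul_add, mul_one, Finset.mul_sum]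
  refine add_le_add hca (Finset.sum_le_sum fun i _ => ?_)
  rw [height_natCast_mul, mul_comm]
  exact mul_le_mul_of_nonneg_left (hcw i) (Nat.cast_nonneg _)

theorem height_latticePoint_pos {d : ℕ} {θ : ℝ} {a : ℂ} {w : Fin d → ℂ}
    (ha : 0 < height θ a) (hw : ∀ i, 0 < height θ (w i)) (n : Fin d → ℕ) :
    0 < height θ (latticePoint a w n) := by
  obtain ⟨c, hc, h⟩ := exists_mul_le_height_latticePoint ha hw
  exact (by positivity : 0 < c * (1 + ∑ i, (n i : ℝ))).trans_le (h n)

theorem summable_branchPow_latticePoint {d : ℕ} {θ : ℝ} {a : ℂ} {w : Fin d → ℂ}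
    (ha : 0 < height θ a) (hw : ∀ i, 0 < height θ (w i)) {α : ℂ} (hα : (d : ℝ) < α.re) :
    Summable fun n => branchPow θ (-α) (latticePoint a w n) := by
  obtain ⟨c, hc, h⟩ := exists_mul_le_height_latticePoint ha hw
  have hd : (0 : ℝ) ≤ d := Nat.cast_nonneg d
  refine Summable.of_norm_bounded (((summable_one_add_sum_rpow d hα).mul_left
    (c ^ (-α.re))).mul_right (Real.exp (|α.im| * (Real.pi + |θ|)))) fun n => ?_
  refine (norm_branchPow_le_height (by rw [Complex.neg_re]; linarith)
    (height_latticePoint_pos ha hw n)).trans ?_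
  rw [Complex.neg_re, Complex.neg_im, abs_neg, ← Real.mul_rpow hc.le (by positivity)]
  refine mul_le_mul_of_nonneg_right ?_ (Real.exp_pos _).le
  exact Real.rpow_le_rpow_of_nonpos (by positivity) (h n) (by linarith)

/-- On the ball of radius `N - d - 1` one has `N + Re α > d + 1`, so the errors decay at a summable
rate uniformly in `α`; the constants are bounded by compactness of the closed ball. -/
theorem exists_summable_bound_errTerm {d : ℕ} {θ : ℝ} {a : ℂ} {w : Fin d → ℂ}
    (ha : 0 < height θ a) (hw : ∀ i, 0 < height θ (w i)) (N : ℕ) :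
    ∃ u : (Fin d → ℕ) → ℝ, Summable u ∧
      ∀ n, ∀ α ∈ Metric.ball (0 : ℂ) (N - d - 1), ‖errTerm θ w N α (latticePoint a w n)‖ ≤ u n := by
  obtain ⟨c, hc, h⟩ := exists_mul_le_height_latticePoint ha hw
  have hcont : Continuous fun α : ℂ => errConst θ w N α * c ^ (-(N + α.re)) :=
    (continuous_errConst θ w N).mul
      (Continuous.rpow continuous_const (by fun_prop) fun _ => Or.inl hc.ne')
  obtain ⟨B, hB⟩ := (isCompact_closedBall (0 : ℂ) (N - d - 1)).bddAbove_image hcont.continuousOn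
  refine ⟨fun n => B * (1 + ∑ i, (n i : ℝ)) ^ (-((d : ℝ) + 1)),
    (summable_one_add_sum_rpow d (by linarith)).mul_left B, fun n α hα => ?_⟩
  have hα' : ‖α‖ < N - d - 1 := by simpa using hα
  have hd : (0 : ℝ) ≤ d := Nat.cast_nonneg d
  have hre := (abs_le.mp (Complex.abs_re_le_norm α)).1
  have hN : 1 ≤ N := by
    have : (0 : ℝ) < N := by linarith [norm_nonneg α]
    exact_mod_cast this
  have hBα : errConst θ w N α * c ^ (-(N + α.re)) ≤ B :=
    hB ⟨α, Metric.ball_subset_closedBall hα, rfl⟩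
  have hS : (1 : ℝ) ≤ 1 + ∑ i, (n i : ℝ) := le_add_of_nonneg_right (by positivity)
  calc ‖errTerm θ w N α (latticePoint a w n)‖
      ≤ errConst θ w N α * height θ (latticePoint a w n) ^ (-(N + α.re)) :=
        norm_errTerm_le hw hN (by linarith) (height_latticePoint_pos ha hw n)
    _ ≤ errConst θ w N α * (c * (1 + ∑ i, (n i : ℝ))) ^ (-(N + α.re)) :=
        mul_le_mul_of_nonneg_left (Real.rpow_le_rpow_of_nonpos (by positivity) (h n)
          (by linarith)) (errConst_nonneg _ _ _ _)
    _ = errConst θ w N α * c ^ (-(N + α.re)) * (1 + ∑ i, (n i : ℝ)) ^ (-(N + α.re)) := by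
        rw [Real.mul_rpow hc.le (by positivity), mul_assoc]
    _ ≤ errConst θ w N α * c ^ (-(N + α.re)) * (1 + ∑ i, (n i : ℝ)) ^ (-((d : ℝ) + 1)) :=
        mul_le_mul_of_nonneg_left (Real.rpow_le_rpow_of_exponent_le hS (by linarith))
          (mul_nonneg (errConst_nonneg _ _ _ _) (by positivity))
    _ ≤ B * (1 + ∑ i, (n i : ℝ)) ^ (-((d : ℝ) + 1)) :=
        mul_le_mul_of_nonneg_right hBα (by positivity)

/-! ### The analytic continuation -/

/-- For nonempty `T` the point `a + M ∑_{i ∈ T} w_i` has height tending to infinity; the omitted `T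
= ∅` would stay at `a`. -/
theorem tendsto_symbolF_zero {d : ℕ} {θ : ℝ} (a : ℂ) {w : Fin d → ℂ}
    (hw : ∀ i, 0 < height θ (w i)) {f : ℂ → ℂ}
    (hf : Tendsto f (comap (height θ) atTop) (𝓝 0)) :
    Tendsto (fun M : ℕ => symbolF f a (fun i => (M : ℂ) * w i)) atTop (𝓝 0) := by
  unfold symbolF
  rw [← Finset.sum_const_zero (s := (Finset.univ : Finset (Finset (Fin d))).filter
    (fun T => T.Nonempty))]
  refine tendsto_finsetSum _ fun T hT => ?_
  rw [← mul_zero ((-1 : ℂ) ^ (d - T.card))]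
  refine (hf.comp (tendsto_comap_iff.mpr ?_)).const_mul _
  simp only [Function.comp_def, ← Finset.mul_sum, height_add, height_natCast_mul]
  refine tendsto_atTop_add_const_left _ _ (tendsto_natCast_atTop_atTop.atTop_mul_const ?_)
  rw [height_sum]
  exact Finset.sum_pos (fun i _ => hw i) (Finset.mem_filter.mp hT).2

theorem tendsto_branchPow_comap_height {θ : ℝ} {s : ℂ} (hs : s.re < 0) :
    Tendsto (branchPow θ s) (comap (height θ) atTop) (𝓝 0) :=
  tendsto_branchPow_zero hs tendsto_comap

/-- The function `(1 - α) ⋯ (d - α) ζ_B(α, a | w)`, given by the expansion of length `N`. -/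
def regZeta {d : ℕ} (θ : ℝ) (a : ℂ) (w : Fin d → ℂ) (N : ℕ) (α : ℂ) : ℂ :=
  (-1) ^ d * mainTerm θ w N α a + ∑' n, errTerm θ w N α (latticePoint a w n)

theorem sum_box_errTerm {d : ℕ} (θ : ℝ) (a : ℂ) (w : Fin d → ℂ) (N M : ℕ) (α : ℂ) :
    ∑ n ∈ Fintype.piFinset (fun _ : Fin d => Finset.range M),
        errTerm θ w N α (latticePoint a w n) =
      fallProd d d α * ∑ n ∈ Fintype.piFinset (fun _ : Fin d => Finset.range M),
          branchPow θ (-α) (latticePoint a w n) -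
        iterDiff (mainTerm θ w N α) a (fun i => (M : ℂ) * w i) := by
  simp only [errTerm, Finset.sum_sub_distrib, Finset.mul_sum, sum_box_iterDiff]

/-- The term `(-1) ^ d mainTerm(a)` of `regZeta` cancels the corner `T = ∅` of the telescoped error
sum. -/
theorem tendsto_regZeta {d : ℕ} {θ : ℝ} {a : ℂ} {w : Fin d → ℂ}
    (ha : 0 < height θ a) (hw : ∀ i, 0 < height θ (w i)) {N : ℕ} {α : ℂ}
    (hα : α ∈ Metric.ball (0 : ℂ) (N - d - 1)) :
    Tendsto (fun M : ℕ =>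
      fallProd d d α * ∑ n ∈ Fintype.piFinset (fun _ : Fin d => Finset.range M),
          branchPow θ (-α) (latticePoint a w n) -
        symbolF (mainTerm θ w N α) a (fun i => (M : ℂ) * w i)) atTop
      (𝓝 (regZeta θ a w N α)) := by
  obtain ⟨u, hu, hbound⟩ := exists_summable_bound_errTerm ha hw N
  have hs : Summable fun n => errTerm θ w N α (latticePoint a w n) :=
    Summable.of_norm_bounded hu fun n => hbound n α hα
  refine ((tendsto_sum_box hs.hasSum).const_add ((-1) ^ d * mainTerm θ w N α a)).congr fun M => ?_
  rw [sum_box_errTerm, iterDiff_eq]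
  ring

theorem symbolF_sub {d : ℕ} (f g : ℂ → ℂ) (a : ℂ) (w : Fin d → ℂ) :
    symbolF (fun z => f z - g z) a w = symbolF f a w - symbolF g a w := by
  simp only [symbolF, mul_sub, Finset.sum_sub_distrib]

theorem symbolF_add {d : ℕ} (f g : ℂ → ℂ) (a : ℂ) (w : Fin d → ℂ) :
    symbolF (fun z => f z + g z) a w = symbolF f a w + symbolF g a w := by
  simp only [symbolF, mul_add, Finset.sum_add_distrib]

theorem symbolF_const_mul {d : ℕ} (c : ℂ) (f : ℂ → ℂ) (a : ℂ) (w : Fin d → ℂ) :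
    symbolF (fun z => c * f z) a w = c * symbolF f a w := by
  simp only [symbolF, Finset.mul_sum, mul_left_comm]

theorem symbolF_finsetSum {d : ℕ} {ι : Type*} (s : Finset ι) (f : ι → ℂ → ℂ) (a : ℂ)
    (w : Fin d → ℂ) :
    symbolF (fun z => ∑ k ∈ s, f k z) a w = ∑ k ∈ s, symbolF (f k) a w := by
  simp only [symbolF, Finset.mul_sum]
  exact Finset.sum_comm

/-- The terms gained by lengthening the expansion are powers with exponent of negative real part, so
their corners vanish in the limit. -/
theorem regZeta_eq_of_le {d : ℕ} {θ : ℝ} {a : ℂ} {w : Fin d → ℂ}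
    (ha : 0 < height θ a) (hw : ∀ i, 0 < height θ (w i)) {N N' : ℕ} (hN : N ≤ N') {α : ℂ}
    (hα : α ∈ Metric.ball (0 : ℂ) (N - d - 1)) :
    regZeta θ a w N α = regZeta θ a w N' α := by
  have hNN : (N : ℝ) ≤ N' := by exact_mod_cast hN
  have hα' : α ∈ Metric.ball (0 : ℂ) (N' - d - 1) := Metric.ball_subset_ball (by linarith) hα
  have hαn : ‖α‖ < N - d - 1 := by simpa using hα
  have hre := (abs_le.mp (Complex.abs_re_le_norm α)).1
  have hd : (0 : ℝ) ≤ d := Nat.cast_nonneg d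
  have hdiff : Tendsto (fun z => mainTerm θ w N' α z - mainTerm θ w N α z)
      (comap (height θ) atTop) (𝓝 0) := by
    have h : ∀ z, mainTerm θ w N' α z - mainTerm θ w N α z =
        ∑ k ∈ Finset.Ico (N + d) (N' + d),
          toddCoeff w k * (fallProd d k α * branchPow θ ((d : ℂ) - k - α) z) := fun z => by
      rw [mainTerm, mainTerm, Finset.sum_Ico_eq_sub _ (by omega)]
    simp only [h]
    rw [← Finset.sum_const_zero (s := Finset.Ico (N + d) (N' + d))]
    refine tendsto_finsetSum _ fun k hk => ?_
    rw [← mul_zero (toddCoeff w k), ← mul_zero (fallProd d k α)]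
    refine ((tendsto_branchPow_comap_height ?_).const_mul _).const_mul _
    have : (N : ℝ) + d ≤ k := by exact_mod_cast (Finset.mem_Ico.mp hk).1
    simp
    linarith
  have h0 := tendsto_symbolF_zero a hw hdiff
  simp only [symbolF_sub] at h0
  have h1 := (tendsto_regZeta ha hw hα).sub h0
  rw [sub_zero] at h1
  refine tendsto_nhds_unique h1 ((tendsto_regZeta ha hw hα').congr fun M => ?_)
  ring

theorem regZeta_eq {d : ℕ} {θ : ℝ} {a : ℂ} {w : Fin d → ℂ}
    (ha : 0 < height θ a) (hw : ∀ i, 0 < height θ (w i)) {N N' : ℕ} {α : ℂ}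
    (hα : α ∈ Metric.ball (0 : ℂ) (N - d - 1)) (hα' : α ∈ Metric.ball (0 : ℂ) (N' - d - 1)) :
    regZeta θ a w N α = regZeta θ a w N' α := by
  rcases le_total N N' with h | h
  · exact regZeta_eq_of_le ha hw h hα
  · exact (regZeta_eq_of_le ha hw h hα').symm

theorem differentiable_mainTerm {d : ℕ} (θ : ℝ) (w : Fin d → ℂ) (N : ℕ) (z : ℂ) :
    Differentiable ℂ fun α => mainTerm θ w N α z := by
  unfold mainTerm
  refine Differentiable.fun_sum fun k _ => Differentiable.const_mul ?_ _
  exact (differentiable_fallProd d k).mul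
    fun α => (hasDerivAt_branchPow_exponent θ z _ α).differentiableAt

theorem differentiable_errTerm {d : ℕ} (θ : ℝ) (w : Fin d → ℂ) (N : ℕ) (z : ℂ) :
    Differentiable ℂ fun α => errTerm θ w N α z := by
  have h : Differentiable ℂ fun α => branchPow θ (-α) z := fun α => by
    simpa using (hasDerivAt_branchPow_exponent θ z 0 α).differentiableAt
  unfold errTerm iterDiff
  refine ((differentiable_fallProd d d).mul h).sub (Differentiable.fun_sum fun T _ => ?_)
  exact (differentiable_mainTerm θ w N _).const_mul _

theorem differentiableOn_regZeta {d : ℕ} {θ : ℝ} {a : ℂ} {w : Fin d → ℂ}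
    (ha : 0 < height θ a) (hw : ∀ i, 0 < height θ (w i)) (N : ℕ) :
    DifferentiableOn ℂ (regZeta θ a w N) (Metric.ball (0 : ℂ) (N - d - 1)) := by
  obtain ⟨u, hu, hbound⟩ := exists_summable_bound_errTerm ha hw N
  exact ((differentiable_mainTerm θ w N a).const_mul _).differentiableOn.add
    (Complex.differentiableOn_tsum_of_summable_norm hu
      (fun n => (differentiable_errTerm θ w N _).differentiableOn) Metric.isOpen_ball hbound)

/-- The entire function `(1 - α) ⋯ (d - α) ζ_B(α, a | w)`. -/
def entireZeta {d : ℕ} (θ : ℝ) (a : ℂ) (w : Fin d → ℂ) (α : ℂ) : ℂ :=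
  regZeta θ a w (⌈‖α‖⌉₊ + d + 2) α

/-- The length used in `entireZeta` jumps with `α`; holomorphy follows once it is replaced by a
fixed length on a ball. -/
theorem entireZeta_eq {d : ℕ} {θ : ℝ} {a : ℂ} {w : Fin d → ℂ}
    (ha : 0 < height θ a) (hw : ∀ i, 0 < height θ (w i)) {N : ℕ} {α : ℂ}
    (hα : α ∈ Metric.ball (0 : ℂ) (N - d - 1)) :
    entireZeta θ a w α = regZeta θ a w N α := by
  refine regZeta_eq ha hw ?_ hα
  have := Nat.le_ceil ‖α‖
  simp
  linarith

theorem exists_mem_ball (d : ℕ) (α : ℂ) : ∃ N : ℕ, α ∈ Metric.ball (0 : ℂ) (N - d - 1) := by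
  obtain ⟨N, hN⟩ := exists_nat_gt (‖α‖ + d + 1)
  exact ⟨N, by simp; linarith⟩

theorem differentiable_entireZeta {d : ℕ} {θ : ℝ} {a : ℂ} {w : Fin d → ℂ}
    (ha : 0 < height θ a) (hw : ∀ i, 0 < height θ (w i)) :
    Differentiable ℂ (entireZeta θ a w) := by
  intro α
  obtain ⟨N, hN⟩ := exists_mem_ball d α
  have hmem := Metric.isOpen_ball.mem_nhds hN
  refine ((differentiableOn_regZeta ha hw N).differentiableAt hmem).congr_of_eventuallyEq ?_
  filter_upwards [hmem] with β hβ using entireZeta_eq ha hw hβ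

/-- For `Re α > d` every exponent `d - k - α` has negative real part, so all corners vanish in the
limit. -/
theorem entireZeta_eq_mul_tsum {d : ℕ} {θ : ℝ} {a : ℂ} {w : Fin d → ℂ}
    (ha : 0 < height θ a) (hw : ∀ i, 0 < height θ (w i)) {α : ℂ} (hα : (d : ℝ) < α.re) :
    entireZeta θ a w α = fallProd d d α * ∑' n, branchPow θ (-α) (latticePoint a w n) := by
  obtain ⟨N, hN⟩ := exists_mem_ball d α
  rw [entireZeta_eq ha hw hN]
  have hmain : Tendsto (mainTerm θ w N α) (comap (height θ) atTop) (𝓝 0) := by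
    unfold mainTerm
    rw [← Finset.sum_const_zero (s := Finset.range (N + d))]
    refine tendsto_finsetSum _ fun k hk => ?_
    rw [← mul_zero (toddCoeff w k), ← mul_zero (fallProd d k α)]
    refine ((tendsto_branchPow_comap_height ?_).const_mul _).const_mul _
    have : (0 : ℝ) ≤ k := Nat.cast_nonneg k
    simp
    linarith
  have h := ((tendsto_sum_box (summable_branchPow_latticePoint ha hw hα).hasSum).const_mul
    (fallProd d d α)).sub (tendsto_symbolF_zero a hw hmain)
  rw [sub_zero] at h
  exact tendsto_nhds_unique (tendsto_regZeta ha hw hN) h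

theorem fallProd_self_ne_zero {d : ℕ} {α : ℂ}
    (hα : α ∈ {α : ℂ | ∃ q : ℕ, 1 ≤ q ∧ q ≤ d ∧ α = q}ᶜ) : fallProd d d α ≠ 0 := by
  refine Finset.prod_ne_zero_iff.mpr fun i hi h => hα ?_
  have hi := Finset.mem_range.mp hi
  refine ⟨d - i, by omega, by omega, ?_⟩
  rw [Nat.cast_sub hi.le]
  linear_combination -h

theorem isZeta_entireZeta_div {d : ℕ} {θ : ℝ} {a : ℂ} {w : Fin d → ℂ}
    (ha : 0 < height θ a) (hw : ∀ i, 0 < height θ (w i)) :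
    IsZeta θ a w fun α => entireZeta θ a w α / fallProd d d α where
  differentiableOn := (differentiable_entireZeta ha hw).differentiableOn.div
    (differentiable_fallProd d d).differentiableOn fun _ => fallProd_self_ne_zero
  hasSum α hα := by
    have hne : fallProd d d α ≠ 0 := by
      refine fallProd_self_ne_zero ?_
      rintro ⟨q, -, hq, rfl⟩
      simp at hα
      omega
    rw [entireZeta_eq_mul_tsum ha hw hα, mul_div_cancel_left₀ _ hne]
    exact (summable_branchPow_latticePoint ha hw hα).hasSum

theorem finite_poles (d : ℕ) : {α : ℂ | ∃ q : ℕ, 1 ≤ q ∧ q ≤ d ∧ α = q}.Finite := by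
  refine ((Finset.Icc 1 d).image (fun q : ℕ => (q : ℂ))).finite_toSet.subset ?_
  rintro _ ⟨q, h1, h2, rfl⟩
  simp only [Finset.coe_image, Set.mem_image, Finset.coe_Icc, Set.mem_Icc]
  exact ⟨q, ⟨h1, h2⟩, rfl⟩

/-- Identity theorem: the plane minus a finite set is connected, and both functions are the same
series near `d + 1`. -/
theorem IsZeta.eqOn {d : ℕ} {θ : ℝ} {a : ℂ} {w : Fin d → ℂ} {Z Z' : ℂ → ℂ}
    (h : IsZeta θ a w Z) (h' : IsZeta θ a w Z') :
    Set.EqOn Z Z' {α : ℂ | ∃ q : ℕ, 1 ≤ q ∧ q ≤ d ∧ α = q}ᶜ := by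
  have hfin := finite_poles d
  have hopen : IsOpen {α : ℂ | ∃ q : ℕ, 1 ≤ q ∧ q ≤ d ∧ α = q}ᶜ := hfin.isClosed.isOpen_compl
  have hconn := (hfin.countable.isConnected_compl_of_one_lt_rank
    (by rw [Complex.rank_real_complex]; exact Cardinal.one_lt_two)).isPreconnected
  refine (h.differentiableOn.analyticOnNhd hopen).eqOn_of_preconnected_of_eventuallyEq
    (h'.differentiableOn.analyticOnNhd hopen) hconn (z₀ := ((d + 1 : ℕ) : ℂ)) ?_ ?_
  · rintro ⟨q, -, hq, he⟩
    have : d + 1 = q := by exact_mod_cast he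
    omega
  · have hmem : {α : ℂ | (d : ℝ) < α.re} ∈ 𝓝 ((d + 1 : ℕ) : ℂ) :=
      (isOpen_lt continuous_const Complex.continuous_re).mem_nhds (by simp)
    filter_upwards [hmem] with α hα
    exact (h.hasSum α hα).unique (h'.hasSum α hα)

/-! ### The finite parts -/

/-- The regular part is the difference quotient of `ψ` at `z₀`, extended by the derivative. -/
theorem hasFinitePart_of_eq_div {f ψ : ℂ → ℂ} {z₀ : ℂ} (hψ : AnalyticAt ℂ ψ z₀)
    (hf : ∀ᶠ z in 𝓝[≠] z₀, f z = ψ z / (z - z₀)) : HasFinitePart f z₀ (deriv ψ z₀) := by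
  obtain ⟨p, hp⟩ := hψ
  refine ⟨ψ z₀, dslope ψ z₀, ⟨_, hp.has_fpower_series_dslope_fslope⟩, dslope_same ψ z₀, ?_⟩
  filter_upwards [hf, self_mem_nhdsWithin] with z hz hne
  have : z - z₀ ≠ 0 := sub_ne_zero.mpr hne
  rw [hz, dslope_of_ne ψ hne, slope_def_field]
  field_simp
  ring

/-! ### Values and logarithmic derivatives of the products at `α = q` -/

theorem fallProd_eq_zero {d q k : ℕ} (hq : q ≤ d) (hk : d - q < k) : fallProd d k q = 0 := by
  refine Finset.prod_eq_zero (Finset.mem_range.mpr hk) ?_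
  rw [Nat.cast_sub hq]
  ring

theorem fallProd_eq_div (q e k : ℕ) (hk : k ≤ e) :
    fallProd (q + e) k q = (e.factorial : ℂ) / ((e - k).factorial : ℂ) := by
  induction k with
  | zero =>
    have : (e.factorial : ℂ) ≠ 0 := by exact_mod_cast e.factorial_ne_zero
    simp [fallProd, this]
  | succ k ih =>
    obtain ⟨j, rfl⟩ : ∃ j, e = k + 1 + j := ⟨e - (k + 1), by omega⟩
    rw [fallProd, Finset.prod_range_succ, ← fallProd, ih (by omega),
      show k + 1 + j - k = j + 1 by omega, Nat.add_sub_cancel_left, Nat.factorial_succ j]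
    have h1 : (j.factorial : ℂ) ≠ 0 := by exact_mod_cast j.factorial_ne_zero
    have h2 : (j : ℂ) + 1 ≠ 0 := Nat.cast_add_one_ne_zero j
    push_cast
    field_simp
    ring

theorem hasDerivAt_fallProd_succ {d k : ℕ} {α c : ℂ} (h : HasDerivAt (fallProd d k) c α) :
    HasDerivAt (fallProd d (k + 1)) (c * ((d : ℂ) - k - α) - fallProd d k α) α := by
  have h2 : HasDerivAt (fun α : ℂ => (d : ℂ) - k - α) (-1) α := by
    simpa using (hasDerivAt_id α).const_sub ((d : ℂ) - k)
  have h3 : fallProd d (k + 1) = fun α => fallProd d k α * ((d : ℂ) - k - α) := by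
    ext α
    rw [fallProd, Finset.prod_range_succ]
    rfl
  rw [h3]
  refine (h.mul h2).congr_deriv ?_
  ring

/-- At `α = q` the factors are `e, e - 1, …, e - k + 1`, nonzero as `k ≤ e`, and each has derivative
`-1`. -/
theorem hasDerivAt_fallProd_of_le (q e k : ℕ) (hk : k ≤ e) :
    HasDerivAt (fallProd (q + e) k)
      (fallProd (q + e) k q * (((harmonic (e - k) : ℚ) : ℂ) - ((harmonic e : ℚ) : ℂ))) q := by
  induction k with
  | zero =>
    have : fallProd (q + e) 0 = fun _ => 1 := by ext; simp [fallProd]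
    simpa [this] using hasDerivAt_const (q : ℂ) (1 : ℂ)
  | succ k ih =>
    refine (hasDerivAt_fallProd_succ (ih (by omega))).congr_deriv ?_
    obtain ⟨j, rfl⟩ : ∃ j, e = k + 1 + j := ⟨e - (k + 1), by omega⟩
    have h2 : (j : ℂ) + 1 ≠ 0 := Nat.cast_add_one_ne_zero j
    have h3 : fallProd (q + (k + 1 + j)) (k + 1) q =
        fallProd (q + (k + 1 + j)) k q * ((j : ℂ) + 1) := by
      rw [fallProd, Finset.prod_range_succ, ← fallProd]
      push_cast
      ring
    rw [h3, show k + 1 + j - k = j + 1 by omega, Nat.add_sub_cancel_left, harmonic_succ]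
    push_cast
    field_simp
    ring

/-- At `α = m + 1` the factors are `-1, -2, …, -k`. -/
theorem hasDerivAt_fallProd_add_one (m k : ℕ) :
    fallProd m k ((m + 1 : ℕ) : ℂ) = (-1) ^ k * (k.factorial : ℂ) ∧
    HasDerivAt (fallProd m k) (fallProd m k ((m + 1 : ℕ) : ℂ) * ((harmonic k : ℚ) : ℂ))
      ((m + 1 : ℕ) : ℂ) := by
  induction k with
  | zero =>
    have : fallProd m 0 = fun _ => 1 := by ext; simp [fallProd]
    simpa [this] using hasDerivAt_const ((m : ℂ) + 1) (1 : ℂ)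
  | succ k ih =>
    have h2 : (k : ℂ) + 1 ≠ 0 := Nat.cast_add_one_ne_zero k
    have h3 : fallProd m (k + 1) ((m + 1 : ℕ) : ℂ) =
        fallProd m k ((m + 1 : ℕ) : ℂ) * (-1 - (k : ℂ)) := by
      rw [fallProd, Finset.prod_range_succ, ← fallProd]
      push_cast
      ring
    constructor
    · rw [h3, ih.1, Nat.factorial_succ]
      push_cast
      ring
    · refine (hasDerivAt_fallProd_succ ih.2).congr_deriv ?_
      rw [h3, harmonic_succ]
      push_cast
      field_simp
      ring

/-- The product of the factors of `(1 - α) ⋯ (d - α)` other than `q - α`. -/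
def cofactor (d q : ℕ) (α : ℂ) : ℂ :=
  fallProd d (d - q) α * fallProd (q - 1) (q - 1) α

theorem fallProd_self_eq {d q : ℕ} (hq : 1 ≤ q) (hqd : q ≤ d) (α : ℂ) :
    fallProd d d α = (q - α) * cofactor d q α := by
  obtain ⟨e, rfl⟩ := Nat.exists_eq_add_of_le' hqd
  obtain ⟨m, rfl⟩ := Nat.exists_eq_add_of_le' hq
  rw [cofactor, Nat.add_sub_cancel, Nat.add_sub_cancel, fallProd, fallProd, fallProd,
    Finset.prod_range_add, Finset.prod_range_succ']
  have : ∀ i : ℕ, (((e + (m + 1) : ℕ) : ℂ) - (e + (i + 1) : ℕ) - α) = (m : ℂ) - i - α := by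
    intro i
    push_cast
    ring
  simp only [this]
  push_cast
  ring

theorem cofactor_apply (q e : ℕ) (hq : 1 ≤ q) :
    cofactor (q + e) q q = (e.factorial : ℂ) * ((-1) ^ (q - 1) * ((q - 1).factorial : ℂ)) := by
  obtain ⟨m, rfl⟩ := Nat.exists_eq_add_of_le' hq
  rw [cofactor, Nat.add_sub_cancel_left, Nat.add_sub_cancel, fallProd_eq_div _ _ _ le_rfl,
    (hasDerivAt_fallProd_add_one m m).1]
  simp

theorem hasDerivAt_cofactor (q e : ℕ) (hq : 1 ≤ q) :
    HasDerivAt (cofactor (q + e) q) (cofactor (q + e) q q *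
      (((harmonic (q - 1) : ℚ) : ℂ) - ((harmonic e : ℚ) : ℂ))) q := by
  obtain ⟨m, rfl⟩ := Nat.exists_eq_add_of_le' hq
  have h := (hasDerivAt_fallProd_of_le (m + 1) e e le_rfl).mul (hasDerivAt_fallProd_add_one m m).2
  have hfun : cofactor (m + 1 + e) (m + 1) = fallProd (m + 1 + e) e * fallProd m m := by
    ext α
    simp [cofactor]
  rw [hfun]
  refine h.congr_deriv ?_
  simp
  ring

theorem hasDerivAt_fallProd_self {d q : ℕ} (hq : 1 ≤ q) (hqd : q ≤ d) :
    HasDerivAt (fallProd d d) (-cofactor d q q) q := by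
  have h1 : DifferentiableAt ℂ (cofactor d q) q :=
    (differentiable_fallProd _ _ _).mul (differentiable_fallProd _ _ _)
  have h2 : HasDerivAt (fun α : ℂ => (q : ℂ) - α) (-1) (q : ℂ) := by
    simpa using (hasDerivAt_id (q : ℂ)).const_sub (q : ℂ)
  rw [show fallProd d d = fun α => (q - α) * cofactor d q α from
    funext (fallProd_self_eq hq hqd)]
  refine (h2.mul h1.hasDerivAt).congr_deriv ?_
  simp

/-! ### The expansion and its derivative at `α = q` -/

theorem symbolF_congr {d : ℕ} {θ : ℝ} {a : ℂ} {w : Fin d → ℂ} (ha : 0 < height θ a)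
    (hw : ∀ i, 0 ≤ height θ (w i)) {f g : ℂ → ℂ} (h : ∀ z, 0 < height θ z → f z = g z) :
    symbolF f a w = symbolF g a w := by
  refine Finset.sum_congr rfl fun T _ => ?_
  rw [h]
  rw [height_add, height_sum]
  exact add_pos_of_pos_of_nonneg ha (Finset.sum_nonneg fun i _ => hw i)

/-- The full iterated difference vanishes, so the nonempty corners equal minus the corner at `a`. -/
theorem symbolF_pow {d n : ℕ} (hn : n < d) (a : ℂ) (w : Fin d → ℂ) :
    symbolF (fun z => z ^ n) a w = -((-1) ^ d * a ^ n) := by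
  have h := iterDiff_eq (fun z => z ^ n) a w
  rw [iterDiff_pow_eq_zero hn] at h
  linear_combination -h

/-- The derivative of `mainTerm` with respect to `α`. -/
def mainTermDeriv {d : ℕ} (θ : ℝ) (w : Fin d → ℂ) (N : ℕ) (α z : ℂ) : ℂ :=
  ∑ k ∈ Finset.range (N + d), toddCoeff w k *
    (deriv (fallProd d k) α * branchPow θ ((d : ℂ) - k - α) z -
      fallProd d k α * (branchLog θ z * branchPow θ ((d : ℂ) - k - α) z))

theorem hasDerivAt_mainTerm {d : ℕ} (θ : ℝ) (w : Fin d → ℂ) (N : ℕ) (α z : ℂ) :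
    HasDerivAt (fun α => mainTerm θ w N α z) (mainTermDeriv θ w N α z) α := by
  unfold mainTerm mainTermDeriv
  refine HasDerivAt.fun_sum fun k _ => HasDerivAt.const_mul _ ?_
  refine ((differentiable_fallProd d k α).hasDerivAt.mul
    (hasDerivAt_branchPow_exponent θ z _ α)).congr_deriv ?_
  ring

theorem deriv_errTerm {d : ℕ} (θ : ℝ) (w : Fin d → ℂ) (N : ℕ) {q : ℕ} (hq : 1 ≤ q) (hqd : q ≤ d)
    (z : ℂ) :
    deriv (fun α => errTerm θ w N α z) q =
      -cofactor d q q * branchPow θ (-q) z - iterDiff (mainTermDeriv θ w N q) z w := by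
  have h1 : HasDerivAt (fun α => branchPow θ (-α) z) (-(branchLog θ z * branchPow θ (-q) z)) q := by
    simpa using hasDerivAt_branchPow_exponent θ z 0 q
  have h2 : HasDerivAt (fun α => iterDiff (mainTerm θ w N α) z w)
      (iterDiff (mainTermDeriv θ w N q) z w) q :=
    HasDerivAt.fun_sum fun T _ => (hasDerivAt_mainTerm θ w N q _).const_mul _
  have h3 := ((hasDerivAt_fallProd_self hq hqd).mul h1).sub h2
  refine HasDerivAt.deriv (h3.congr_deriv ?_)
  rw [fallProd_eq_zero hqd (by omega)]
  ring

theorem sum_range_add_eq {d q e N : ℕ} (hd : d = q + e) (hq : 1 ≤ q) (f : ℕ → ℂ) :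
    ∑ k ∈ Finset.range (N + d), f k =
      ∑ k ∈ Finset.range (e + 1), f k + ∑ k ∈ Finset.Ico (e + 1) (N + d), f k :=
  (Finset.sum_range_add_sum_Ico f (by omega)).symm

theorem branchPow_sub_natCast {θ : ℝ} {q e k : ℕ} (hk : k ≤ e) {z : ℂ} (hz : z ≠ 0) :
    branchPow θ (((q + e : ℕ) : ℂ) - k - q) z = z ^ (e - k) := by
  rw [← branchPow_natCast θ _ hz, Nat.cast_sub hk]
  push_cast
  congr 1
  ring

theorem mainTerm_natCast {q e : ℕ} {θ : ℝ} (w : Fin (q + e) → ℂ) (N : ℕ) (hq : 1 ≤ q) {z : ℂ}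
    (hz : z ≠ 0) :
    mainTerm θ w N q z =
      ∑ k ∈ Finset.range (e + 1), toddCoeff w k * fallProd (q + e) k q * z ^ (e - k) := by
  rw [mainTerm, sum_range_add_eq rfl hq, add_eq_left.mpr]
  · refine Finset.sum_congr rfl fun k hk => ?_
    rw [branchPow_sub_natCast (by simpa [Nat.lt_succ_iff] using hk) hz, mul_assoc]
  · refine Finset.sum_eq_zero fun k hk => ?_
    rw [fallProd_eq_zero (by omega) (by have := (Finset.mem_Ico.mp hk).1; omega)]
    ring

/-- For `k > e` the product vanishes at `q` but its derivative need not: such terms carry no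
logarithm, only a decaying power. -/
theorem mainTermDeriv_natCast {q e : ℕ} {θ : ℝ} (w : Fin (q + e) → ℂ) (N : ℕ) (hq : 1 ≤ q) {z : ℂ}
    (hz : z ≠ 0) :
    mainTermDeriv θ w N q z =
      ∑ k ∈ Finset.range (e + 1), toddCoeff w k * deriv (fallProd (q + e) k) q * z ^ (e - k) -
      ∑ k ∈ Finset.range (e + 1), toddCoeff w k * fallProd (q + e) k q *
        (z ^ (e - k) * branchLog θ z) +
      ∑ k ∈ Finset.Ico (e + 1) (N + (q + e)), toddCoeff w k * deriv (fallProd (q + e) k) q *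
        branchPow θ (((q + e : ℕ) : ℂ) - k - q) z := by
  rw [mainTermDeriv, sum_range_add_eq rfl hq, ← Finset.sum_sub_distrib]
  congr 1
  · refine Finset.sum_congr rfl fun k hk => ?_
    rw [branchPow_sub_natCast (by simpa [Nat.lt_succ_iff] using hk) hz]
    ring
  · refine Finset.sum_congr rfl fun k hk => ?_
    rw [fallProd_eq_zero (by omega) (by have := (Finset.mem_Ico.mp hk).1; omega)]
    ring

/-- The box sums enter with the factor `fallProd d d q = 0`, and `mainTerm` is a polynomial of
degree at most `e < q + e`, so the sequence in `tendsto_regZeta` is constant. -/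
theorem regZeta_natCast {q e : ℕ} {θ : ℝ} {a : ℂ} {w : Fin (q + e) → ℂ}
    (ha : 0 < height θ a) (hw : ∀ i, 0 < height θ (w i)) (hq : 1 ≤ q) {N : ℕ}
    (hN : (q : ℂ) ∈ Metric.ball (0 : ℂ) (N - (q + e : ℕ) - 1)) :
    regZeta θ a w N q = (-1) ^ (q + e) *
      ∑ k ∈ Finset.range (e + 1), toddCoeff w k * fallProd (q + e) k q * a ^ (e - k) := by
  refine tendsto_nhds_unique (tendsto_regZeta ha hw hN) (tendsto_const_nhds.congr fun M => ?_)
  have hMw : ∀ i, 0 ≤ height θ ((M : ℂ) * w i) := fun i => by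
    rw [height_natCast_mul]
    exact mul_nonneg (Nat.cast_nonneg _) (hw i).le
  rw [symbolF_congr ha hMw fun z hz => mainTerm_natCast w N hq (ne_zero_of_height_pos hz),
    symbolF_finsetSum, fallProd_eq_zero (by omega) (by omega), Finset.mul_sum, zero_mul, zero_sub,
    ← Finset.sum_neg_distrib]
  refine Finset.sum_congr rfl fun k _ => ?_
  rw [symbolF_const_mul, symbolF_pow (by omega)]
  ring

theorem deriv_regZeta {d : ℕ} {θ : ℝ} {a : ℂ} {w : Fin d → ℂ}
    (ha : 0 < height θ a) (hw : ∀ i, 0 < height θ (w i)) {N : ℕ} {α : ℂ}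
    (hα : α ∈ Metric.ball (0 : ℂ) (N - d - 1)) :
    HasSum (fun n => deriv (fun α => errTerm θ w N α (latticePoint a w n)) α)
      (deriv (regZeta θ a w N) α - (-1) ^ d * mainTermDeriv θ w N α a) := by
  obtain ⟨u, hu, hbound⟩ := exists_summable_bound_errTerm ha hw N
  have hdiff := fun n : Fin d → ℕ =>
    (differentiable_errTerm θ w N (latticePoint a w n)).differentiableOn (s :=
      Metric.ball (0 : ℂ) (N - d - 1))
  have h := Complex.hasSum_deriv_of_summable_norm hu hdiff Metric.isOpen_ball hbound hα
  have h1 := ((Complex.differentiableOn_tsum_of_summable_norm hu hdiff Metric.isOpen_ball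
    hbound).differentiableAt (Metric.isOpen_ball.mem_nhds hα)).hasDerivAt
  have h2 := ((hasDerivAt_mainTerm θ w N α a).const_mul ((-1) ^ d)).add h1
  have h3 : deriv (regZeta θ a w N) α = _ := h2.deriv
  rwa [h3, add_sub_cancel_left]

/-- The limit of the regularized box sums, in terms of the derivative of `regZeta`. -/
theorem tendsto_regularized_sum {q e : ℕ} {θ : ℝ} {a : ℂ} {w : Fin (q + e) → ℂ}
    (ha : 0 < height θ a) (hw : ∀ i, 0 < height θ (w i)) (hq : 1 ≤ q) {N : ℕ}
    (hN : (q : ℂ) ∈ Metric.ball (0 : ℂ) (N - (q + e : ℕ) - 1)) :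
    Tendsto (fun M : ℕ =>
      ∑ k ∈ Finset.range (e + 1), toddCoeff w k * fallProd (q + e) k q *
          symbolF (fun z => z ^ (e - k) * branchLog θ z) a (fun i => (M : ℂ) * w i) -
        cofactor (q + e) q q * ∑ n ∈ Fintype.piFinset (fun _ : Fin (q + e) => Finset.range M),
          (latticePoint a w n ^ q)⁻¹) atTop
      (𝓝 (deriv (regZeta θ a w N) q - (-1) ^ (q + e) * ∑ k ∈ Finset.range (e + 1),
        toddCoeff w k * deriv (fallProd (q + e) k) q * a ^ (e - k))) := by
  have hrest : Tendsto (fun z => ∑ k ∈ Finset.Ico (e + 1) (N + (q + e)),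
      toddCoeff w k * deriv (fallProd (q + e) k) q *
        branchPow θ (((q + e : ℕ) : ℂ) - k - q) z) (comap (height θ) atTop) (𝓝 0) := by
    rw [← Finset.sum_const_zero (s := Finset.Ico (e + 1) (N + (q + e)))]
    refine tendsto_finsetSum _ fun k hk => ?_
    rw [← mul_zero (toddCoeff w k * deriv (fallProd (q + e) k) q)]
    refine (tendsto_branchPow_comap_height ?_).const_mul _
    have : (e : ℝ) + 1 ≤ k := by exact_mod_cast (Finset.mem_Ico.mp hk).1
    simp
    linarith
  -- The added constant cancels both the corner of `mainTermDeriv` at `a` and the polynomial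
  -- corners, which do not depend on `M`; `hrest` disposes of the decaying powers.
  have h := ((tendsto_sum_box (deriv_regZeta ha hw hN)).add
    (tendsto_symbolF_zero a hw hrest)).add_const ((-1) ^ (q + e) * (mainTermDeriv θ w N q a -
      ∑ k ∈ Finset.range (e + 1), toddCoeff w k * deriv (fallProd (q + e) k) q * a ^ (e - k)))
  rw [show ∀ x y z : ℂ, x - (-1) ^ (q + e) * y + 0 + (-1) ^ (q + e) * (y - z) =
    x - (-1) ^ (q + e) * z by intros; ring] at h
  refine h.congr fun M => ?_
  have hMw : ∀ i, 0 ≤ height θ ((M : ℂ) * w i) := fun i => by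
    rw [height_natCast_mul]
    exact mul_nonneg (Nat.cast_nonneg _) (hw i).le
  have hpow : ∑ k ∈ Finset.range (e + 1), toddCoeff w k * deriv (fallProd (q + e) k) q *
      symbolF (fun z => z ^ (e - k)) a (fun i => (M : ℂ) * w i) =
      -((-1) ^ (q + e) * ∑ k ∈ Finset.range (e + 1),
        toddCoeff w k * deriv (fallProd (q + e) k) q * a ^ (e - k)) := by
    rw [Finset.mul_sum, ← Finset.sum_neg_distrib]
    refine Finset.sum_congr rfl fun k _ => ?_
    rw [symbolF_pow (by omega)]
    ring
  have hsymb := symbolF_congr ha hMw fun z hz =>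
    mainTermDeriv_natCast (θ := θ) w N hq (ne_zero_of_height_pos hz)
  simp only [symbolF_add, symbolF_sub, symbolF_finsetSum (Finset.range (e + 1)),
    symbolF_const_mul, hpow] at hsymb
  have hbox : ∑ n ∈ Fintype.piFinset (fun _ : Fin (q + e) => Finset.range M),
      deriv (fun α => errTerm θ w N α (latticePoint a w n)) q =
      -cofactor (q + e) q q * ∑ n ∈ Fintype.piFinset (fun _ : Fin (q + e) => Finset.range M),
          (latticePoint a w n ^ q)⁻¹ -
        iterDiff (mainTermDeriv θ w N q) a (fun i => (M : ℂ) * w i) := by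
    rw [← sum_box_iterDiff, Finset.mul_sum, ← Finset.sum_sub_distrib]
    refine Finset.sum_congr rfl fun n _ => ?_
    rw [deriv_errTerm θ w N hq (by omega),
      branchPow_neg_natCast θ q (ne_zero_of_height_pos (height_latticePoint_pos ha hw n))]
  rw [hbox, iterDiff_eq, hsymb]
  ring

/-- Near `q` the function is `-(regZeta / cofactor) / (α - q)`; the quotient rule with the
logarithmic derivative of `cofactor` gives the finite part. -/
theorem hasFinitePart_zeta {q e : ℕ} {θ : ℝ} {a : ℂ} {w : Fin (q + e) → ℂ}
    (ha : 0 < height θ a) (hw : ∀ i, 0 < height θ (w i)) (hq : 1 ≤ q) {N : ℕ}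
    (hN : (q : ℂ) ∈ Metric.ball (0 : ℂ) (N - (q + e : ℕ) - 1)) {Z : ℂ → ℂ}
    (hZ : IsZeta θ a w Z) :
    HasFinitePart Z q ((regZeta θ a w N q * (((harmonic (q - 1) : ℚ) : ℂ) -
      ((harmonic e : ℚ) : ℂ)) - deriv (regZeta θ a w N) q) / cofactor (q + e) q q) := by
  have hmem := Metric.isOpen_ball.mem_nhds hN
  have hc0 : cofactor (q + e) q q ≠ 0 := by
    have h1 : (e.factorial : ℂ) ≠ 0 := by exact_mod_cast e.factorial_ne_zero
    have h2 : ((q - 1).factorial : ℂ) ≠ 0 := by exact_mod_cast (q - 1).factorial_ne_zero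
    rw [cofactor_apply q e hq]
    exact mul_ne_zero h1 (mul_ne_zero (pow_ne_zero _ (by norm_num)) h2)
  have hcdiff : Differentiable ℂ (cofactor (q + e) q) :=
    (differentiable_fallProd _ _).mul (differentiable_fallProd _ _)
  have hreg := differentiableOn_regZeta ha hw N
  have hψ : AnalyticAt ℂ (fun α => -(regZeta θ a w N α / cofactor (q + e) q α)) q :=
    ((hreg.analyticAt hmem).div (hcdiff.analyticAt _) hc0).neg
  have hderiv : deriv (fun α => -(regZeta θ a w N α / cofactor (q + e) q α)) q =
      (regZeta θ a w N q * (((harmonic (q - 1) : ℚ) : ℂ) - ((harmonic e : ℚ) : ℂ)) -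
        deriv (regZeta θ a w N) q) / cofactor (q + e) q q := by
    have h : deriv (fun α => -(regZeta θ a w N α / cofactor (q + e) q α)) q = _ :=
      ((hreg.differentiableAt hmem).hasDerivAt.div (hasDerivAt_cofactor q e hq) hc0).neg.deriv
    rw [h]
    field_simp
    ring
  rw [← hderiv]
  refine hasFinitePart_of_eq_div hψ ?_
  have hpoles : ∀ᶠ α in 𝓝[≠] (q : ℂ),
      α ∈ {α : ℂ | ∃ q' : ℕ, 1 ≤ q' ∧ q' ≤ q + e ∧ α = q'}ᶜ := by
    have h := ((finite_poles (q + e)).subset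
      (Set.sdiff_subset (t := {(q : ℂ)}))).isClosed.isOpen_compl.mem_nhds (x := (q : ℂ)) (by simp)
    filter_upwards [mem_nhdsWithin_of_mem_nhds h, self_mem_nhdsWithin] with α h1 h2 h3
    exact h1 ⟨h3, h2⟩
  filter_upwards [hpoles, mem_nhdsWithin_of_mem_nhds hmem, self_mem_nhdsWithin] with α h1 h2 h3
  have hZα : Z α = entireZeta θ a w α / fallProd (q + e) (q + e) α :=
    hZ.eqOn (isZeta_entireZeta_div ha hw) h1
  rw [hZα, entireZeta_eq ha hw h2,
    fallProd_self_eq hq (by omega), ← neg_sub α (q : ℂ), neg_mul, div_neg, ← div_div,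
    div_right_comm, neg_div]

end Barnes

end

theorem mainTheorem4 {d : ℕ} (θ : ℝ) (a : ℂ) (w : Fin d → ℂ)
    (ha : a ∈ Barnes.halfPlane θ) (hw : ∀ i, w i ∈ Barnes.halfPlane θ) :
    Barnes.IsZeta θ a w (Barnes.zeta θ a w) ∧
    ∀ q : ℕ, 1 ≤ q → q ≤ d →
      ∃ L : ℂ,
        Filter.Tendsto
          (fun M : ℕ =>
            (-1) ^ q / ((q - 1).factorial : ℂ) *
                ∑ m ∈ Finset.range (d - q + 1),
                  Barnes.bernoullianCoeff w m /
                      ((m.factorial : ℂ) * ((d - q - m).factorial : ℂ)) *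
                    Barnes.symbolF (fun z => z ^ (d - q - m) * Barnes.branchLog θ z) a
                      (fun i => (M : ℂ) * w i)
              + ∑ n ∈ Fintype.piFinset (fun _ : Fin d => Finset.range M),
                  (Barnes.latticePoint a w n ^ q)⁻¹)
          Filter.atTop (nhds L) ∧
        Barnes.HasFinitePart (Barnes.zeta θ a w) (q : ℂ)
          (L + (-1) ^ (d - q + 1) / ((q - 1).factorial : ℂ) *
            ∑ m ∈ Finset.range (d - q + 1),
              Barnes.bernoullianCoeff w m * a ^ (d - q - m) /
                  ((m.factorial : ℂ) * ((d - q - m).factorial : ℂ)) *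
                (((harmonic (q - 1) : ℚ) : ℂ) - ((harmonic (d - q - m) : ℚ) : ℂ))) := by
  have hZ : Barnes.IsZeta θ a w (Barnes.zeta θ a w) :=
    Classical.epsilon_spec ⟨_, Barnes.isZeta_entireZeta_div ha hw⟩
  refine ⟨hZ, fun q hq hqd => ?_⟩
  obtain ⟨e, rfl⟩ := Nat.exists_eq_add_of_le hqd
  obtain ⟨N, hN⟩ := Barnes.exists_mem_ball (q + e) (q : ℂ)
  rw [Nat.add_sub_cancel_left]
  have hq0 : ((q - 1).factorial : ℂ) ≠ 0 := by exact_mod_cast (q - 1).factorial_ne_zero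
  have he0 : (e.factorial : ℂ) ≠ 0 := by exact_mod_cast e.factorial_ne_zero
  have hsign : (-1 : ℂ) ^ q * (-1) ^ q = 1 := by rw [← mul_pow]; simp
  have hr : Barnes.cofactor (q + e) q q =
      -((e.factorial : ℂ) * ((-1) ^ q * (q - 1).factorial)) := by
    rw [Barnes.cofactor_apply q e hq]
    obtain ⟨m, rfl⟩ := Nat.exists_eq_add_of_le' hq
    rw [Nat.add_sub_cancel, pow_succ]
    ring
  have hr0 : Barnes.cofactor (q + e) q q ≠ 0 := by
    rw [hr]
    exact neg_ne_zero.mpr (mul_ne_zero he0 (mul_ne_zero (pow_ne_zero _ (by norm_num)) hq0))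
  -- The `e!` in `fallProd` cancels that of `cofactor`, and the `m!` absorbs the one in
  -- `bernoullianCoeff`.
  have hcoeff : ∀ m ∈ Finset.range (e + 1),
      Barnes.toddCoeff w m * Barnes.fallProd (q + e) m q / Barnes.cofactor (q + e) q q =
        -((-1) ^ q / ((q - 1).factorial : ℂ) * (Barnes.bernoullianCoeff w m /
          ((m.factorial : ℂ) * ((e - m).factorial : ℂ)))) := by
    intro m hm
    have h1 : (m.factorial : ℂ) ≠ 0 := by exact_mod_cast m.factorial_ne_zero
    have h2 : ((e - m).factorial : ℂ) ≠ 0 := by exact_mod_cast (e - m).factorial_ne_zero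
    have h3 : (-1 : ℂ) ^ q ≠ 0 := pow_ne_zero _ (by norm_num)
    rw [Barnes.fallProd_eq_div q e m (by simpa [Nat.lt_succ_iff] using hm), hr,
      Barnes.bernoullianCoeff_eq (by omega)]
    field_simp
    linear_combination Barnes.toddCoeff w m * hsign
  have hlim := (Barnes.tendsto_regularized_sum ha hw hq hN).div_const (-Barnes.cofactor (q + e) q q)
  refine ⟨_, hlim.congr fun M => ?_, ?_⟩
  · have hsum : ∑ k ∈ Finset.range (e + 1), Barnes.toddCoeff w k * Barnes.fallProd (q + e) k q *
        Barnes.symbolF (fun z => z ^ (e - k) * Barnes.branchLog θ z) a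
          (fun i => (M : ℂ) * w i) =
        -Barnes.cofactor (q + e) q q * ((-1) ^ q / ((q - 1).factorial : ℂ) *
          ∑ m ∈ Finset.range (e + 1), Barnes.bernoullianCoeff w m /
            ((m.factorial : ℂ) * ((e - m).factorial : ℂ)) *
              Barnes.symbolF (fun z => z ^ (e - m) * Barnes.branchLog θ z) a
                (fun i => (M : ℂ) * w i)) := by
      rw [Finset.mul_sum, Finset.mul_sum]
      refine Finset.sum_congr rfl fun m hm => ?_
      rw [(div_eq_iff hr0).mp (hcoeff m hm)]
      ring
    rw [hsum, div_eq_iff (neg_ne_zero.mpr hr0)]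
    ring
  -- `H_e` occurs in the logarithmic derivatives of both `cofactor` and `fallProd` and cancels,
  -- leaving `H_{q-1} - H_{e-m}`.
  · have hsum : (-1) ^ (e + 1) / ((q - 1).factorial : ℂ) * ∑ m ∈ Finset.range (e + 1),
        Barnes.bernoullianCoeff w m * a ^ (e - m) /
          ((m.factorial : ℂ) * ((e - m).factorial : ℂ)) *
            (((harmonic (q - 1) : ℚ) : ℂ) - ((harmonic (e - m) : ℚ) : ℂ)) =
        ((-1) ^ (q + e) * (∑ k ∈ Finset.range (e + 1),
            Barnes.toddCoeff w k * Barnes.fallProd (q + e) k q * a ^ (e - k)) *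
              (((harmonic (q - 1) : ℚ) : ℂ) - ((harmonic e : ℚ) : ℂ)) -
          (-1) ^ (q + e) * ∑ k ∈ Finset.range (e + 1),
            Barnes.toddCoeff w k * deriv (Barnes.fallProd (q + e) k) q * a ^ (e - k)) /
          Barnes.cofactor (q + e) q q := by
      rw [eq_div_iff hr0]
      simp only [Finset.mul_sum, Finset.sum_mul]
      rw [← Finset.sum_sub_distrib]
      refine Finset.sum_congr rfl fun m hm => ?_
      have hc := (div_eq_iff hr0).mp (hcoeff m hm)
      rw [(Barnes.hasDerivAt_fallProd_of_le q e m
        (by simpa [Nat.lt_succ_iff] using hm)).deriv]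
      trans (-1) ^ (q + e) * (Barnes.toddCoeff w m * Barnes.fallProd (q + e) m q) * a ^ (e - m) *
        (((harmonic (q - 1) : ℚ) : ℂ) - ((harmonic (e - m) : ℚ) : ℂ))
      · rw [hc, pow_add, pow_succ]
        linear_combination (-1) ^ e * (Barnes.bernoullianCoeff w m /
          ((m.factorial : ℂ) * ((e - m).factorial : ℂ))) * (1 / ((q - 1).factorial : ℂ)) *
            a ^ (e - m) * (((harmonic (q - 1) : ℚ) : ℂ) - ((harmonic (e - m) : ℚ) : ℂ)) *
              Barnes.cofactor (q + e) q q * hsign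
      · ring
    rw [hsum]
    convert! Barnes.hasFinitePart_zeta ha hw hq hN hZ using 1
    rw [Barnes.regZeta_natCast ha hw hq hN, div_neg, ← sub_eq_neg_add, ← sub_div]
    ring
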